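/- Graphs are simple and connected, with graph distance $d$. For a graph $H$ with countably many vertices, $p_c^{\mathrm{site}}(H)$ (resp. $p_c^{\mathrm{bond}}(H)$) is the supremum of the $p\in[0,1]$ for which Bernoulli site (resp. bond) percolation of parameter $p$ on $H$ almost surely has no infinite cluster. For real numbers $a,b\ge 1$, an $(a,b)$-net of a graph $\mathcal G=(V,E)$ is a set $V_0\subseteq V$ such that $d(x,y)\ge a$ for all distinct $x,y\in V_0$, and such that every $y\in V$ satisfies $d(x,y)\le b$ for some $x\in V_0$. An $(a,b)$-net is regarded as a graph by declaring two distinct elements $x,y\in V_0$ adjacent when $d(x,y)\le 4b$. A collection of transitive graphs has $C$-controlled nets if, for every real $a\ge 1$, every graph of the collection admits an $(a,Ca)$-net $V_0$ with $p_c^{\mathrm{site}}(V_0)\le \tfrac34$. **Lemma.** Let $p_c$ denote either $p_c^{\mathrm{site}}$ or $p_c^{\mathrm{bond}}$. The collection of all Cayley graphs $\mathcal G$ of nilpotent groups (with respect to finite generating sets) such that $p_c(\mathcal G)<1$ has $2$-controlled nets. That is, for every real $a\ge 1$, each such $\mathcal G$ admits an $(a,2a)$-net $V_0$ with $p_c^{\mathrm{site}}(V_0)\le\tfrac34$.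 -/

import Mathlib

open MeasureTheory ProbabilityTheory

universe u

noncomputable section

namespace NilpotentNets

/-! ### Percolation and critical parameters -/

/-- Some connected component of the graph `H` has infinitely many vertices. -/
def HasInfiniteCluster {W : Type u} (H : SimpleGraph W) : Prop :=
  ∃ c : H.ConnectedComponent, c.supp.Infinite

/-- The event, for a set `ω` of open vertices, that there is an infinite open cluster. -/
def siteEvent {V : Type u} (G : SimpleGraph V) : Set (Set V) :=
  {ω | HasInfiniteCluster (G.induce ω)}

/-- The event, for a set `ω` of open edges, that there is an infinite open cluster. -/
def bondEvent {V : Type u} (G : SimpleGraph V) : Set (Set G.edgeSet) :=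
  {ω | HasInfiniteCluster (SimpleGraph.fromEdgeSet (Subtype.val '' ω))}

/-- The critical parameter of Bernoulli site percolation: the supremum of the `p ∈ [0,1]` such that
almost surely there is no infinite cluster when every vertex is open independently with
probability `p`. The set contains `0`, and it is all of `[0,1]` if `V` is finite. -/
def pcSite {V : Type u} (G : SimpleGraph V) : ℝ :=
  sSup {x : ℝ | ∃ p : unitInterval, (p : ℝ) = x ∧
    setBernoulli (Set.univ : Set V) p (siteEvent G) = 0}

/-- The critical parameter of Bernoulli bond percolation, where every edge is open independently
with probability `p`. -/
def pcBond {V : Type u} (G : SimpleGraph V) : ℝ :=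
  sSup {x : ℝ | ∃ p : unitInterval, (p : ℝ) = x ∧
    setBernoulli (Set.univ : Set G.edgeSet) p (bondEvent G) = 0}

/-! ### Nets -/

/-- `V₀` is an `(a, b)`-net of the (connected) graph `G`: it is `a`-separated and `b`-dense for the
graph distance. -/
structure IsNet {V : Type u} (G : SimpleGraph V) (a b : ℝ) (V₀ : Set V) : Prop where
  separated : ∀ x ∈ V₀, ∀ y ∈ V₀, x ≠ y → a ≤ (G.dist x y : ℝ)
  dense : ∀ y : V, ∃ x ∈ V₀, (G.dist x y : ℝ) ≤ b

/-- The graph structure on an `(a, b)`-net `V₀` of `G`: two distinct elements are adjacent if they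
are at distance at most `4 * b` in `G`. -/
def netGraph {V : Type u} (G : SimpleGraph V) (b : ℝ) (V₀ : Set V) : SimpleGraph V₀ where
  Adj x y := x ≠ y ∧ (G.dist (x : V) (y : V) : ℝ) ≤ 4 * b
  symm := ⟨fun x y h => ⟨h.1.symm, by rw [SimpleGraph.dist_comm]; exact h.2⟩⟩
  loopless := ⟨fun _ h => h.1 rfl⟩

/-- A collection of (connected, transitive) graphs, given by its membership predicate, has
`C`-controlled nets. -/
def HasControlledNets (collection : ∀ V : Type u, SimpleGraph V → Prop) (C : ℝ) : Prop :=
  ∀ a : ℝ, 1 ≤ a → ∀ (V : Type u) (G : SimpleGraph V), collection V G →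
    ∃ V₀ : Set V, IsNet G a (C * a) V₀ ∧ pcSite (netGraph G (C * a) V₀) ≤ 3 / 4

/-! ### Cayley graphs -/

/-- `G` is a Cayley graph of a nilpotent group: its vertex set carries a nilpotent group structure
and a finite generating subset `S` such that distinct `x`, `y` are adjacent if and only if
`y = x * s` or `x = y * s` for some `s ∈ S`. -/
def IsNilpotentCayleyGraph {V : Type u} (G : SimpleGraph V) : Prop :=
  ∃ _ : Group V, Group.IsNilpotent V ∧
    ∃ S : Set V, S.Finite ∧ Subgroup.closure S = ⊤ ∧ G = SimpleGraph.mulCayley S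

end NilpotentNets

end

/-!
Write `V` for the nilpotent group. If all homomorphisms `V → ℤ` are proportional (`RankLeOne`), then
`V` has a homomorphism to `ℤ` with finite kernel (`RankLeOne.exists_finite_ker`): by induction along
`V ⧸ center V`, the centre has finite index, so the commutator subgroup is finite by Schur's
theorem, and the abelianization is finitely generated of rank at most one. The levels of such a map
cut the Cayley graph into pieces joined by boundedly many vertices and edges, and at every density
below one infinitely many of these cuts are closed in each direction, so that both critical
parameters are one (`HasThinSlabs.one_le_pcSite`, `HasThinSlabs.one_le_pcBond`).

Hence `V` has two independent homomorphisms to `ℤ`. Choosing generators `s`, `t` on which a minor is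
largest (`exists_auerbach`) gives rational coordinates on `V` which are `1`-Lipschitz for the word
metric and in which `s` and `t` are the two unit vectors. So one can move by any integer vector at a
cost of at most its `ℓ¹` norm.

Let `V₀` be any maximal `a`-separated set, and let `n` be the largest natural number less than `a`.
Every point is within `n` of `V₀`. Tile the plane by squares of side `2 n + 1` in the pattern of the
triangular lattice. From a point of `V₀` over one tile one can move to the centre of any adjacent
tile and then to a point of `V₀`, which still lies over that tile; the total distance is at most
`6 n + 2 ≤ 8 a`, so this point is a neighbour in the graph on the net. Steps of the triangular
lattice therefore lift to the net. Such a lifting need not provide a subgraph isomorphic to the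
lattice, but an exploration of the cluster reveals at most one lift of each tile, so the net percolates
whenever the triangular lattice does (`real_reached_subset_le`).

Finally the triangular lattice, even in a half-plane, percolates at densities above `3 / 4`
(`real_halfTri_bad_le`). If the cluster of a long open segment on the bottom line is finite, then
its outer boundary contains a closed path across it (`exists_boundary_crossing`). After
shortcutting, each step of that path has three possible directions, and `3 (1 - p) < 3 / 4`, so such
paths are unlikely when the segment is long.
-/

noncomputable section

namespace NilpotentNets

/-! ### Cylinder events of Bernoulli percolation -/

theorem measurableSet_mem {ι : Type*} (i : ι) : MeasurableSet {ω : Set ι | i ∈ ω} :=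
  measurableSet_setOfPred.2 (measurable_set_mem i)

theorem setBernoulli_real_forall_mem_iff {ι : Type*} (p : unitInterval) (A : Finset ι)
    (P : ι → Prop) [DecidablePred P] :
    (setBernoulli (Set.univ : Set ι) p).real {ω | ∀ i ∈ A, (i ∈ ω ↔ P i)} =
      ∏ i ∈ A, if P i then (p : ℝ) else 1 - p := by
  have h : setBernoulli (Set.univ : Set ι) p {ω | ∀ i ∈ A, (i ∈ ω ↔ P i)} =
      ∏ i ∈ A, if P i then (unitInterval.toNNReal p : ENNReal)
        else (unitInterval.toNNReal (unitInterval.symm p) : ENNReal) := by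
    rw [setBernoulli_apply']
    have : ((fun p : ι → Prop ↦ {i | p i}) ⁻¹' {ω : Set ι | ∀ i ∈ A, (i ∈ ω ↔ P i)}) =
        Set.pi (A : Set ι) (fun i => {P i}) := by
      ext f; simp [Set.mem_pi]
    rw [this, Measure.infinitePi_pi _ (fun i _ => MeasurableSet.of_discrete)]
    refine Finset.prod_congr rfl fun i _ => ?_
    split_ifs with h <;> simp [h, Set.indicator]
  rw [measureReal_def, h, ENNReal.toReal_prod]
  refine Finset.prod_congr rfl fun i _ => ?_
  split_ifs <;> simp

/-- The cylinder formula along an injective labelling of sites: the probability depends only on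
the prescribed states. -/
theorem setBernoulli_real_forall_mem_iff_of_injOn {τ ι : Type*} (p : unitInterval) (A : Finset τ)
    (x : τ → ι) (hx : Set.InjOn x A) (P : τ → Prop) [DecidablePred P] :
    (setBernoulli (Set.univ : Set ι) p).real {ω | ∀ w ∈ A, (x w ∈ ω ↔ P w)} =
      ∏ w ∈ A, if P w then (p : ℝ) else 1 - p := by
  classical
  have key : ∀ w ∈ A, ((∃ w' ∈ A, x w' = x w ∧ P w') ↔ P w) := by
    intro w hw
    constructor
    · rintro ⟨w', hw', he, hP⟩
      rwa [← hx hw' hw he]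
    · exact fun h => ⟨w, hw, rfl, h⟩
  have := setBernoulli_real_forall_mem_iff p (A.image x) (fun i => ∃ w' ∈ A, x w' = i ∧ P w')
  rw [Finset.prod_image hx] at this
  have hset : {ω : Set ι | ∀ w ∈ A, (x w ∈ ω ↔ P w)} =
      {ω | ∀ i ∈ A.image x, (i ∈ ω ↔ ∃ w' ∈ A, x w' = i ∧ P w')} := by
    ext ω
    simp only [Set.mem_ofPred_eq, Finset.forall_mem_image]
    exact forall₂_congr fun w hw => by rw [key w hw]
  rw [hset, this]
  exact Finset.prod_congr rfl fun w hw => by simp only [key w hw]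

theorem setBernoulli_real_forall_notMem {ι : Type*} (p : unitInterval) (A : Finset ι) :
    (setBernoulli (Set.univ : Set ι) p).real {ω | ∀ i ∈ A, i ∉ ω} = (1 - (p : ℝ)) ^ A.card := by
  simpa using setBernoulli_real_forall_mem_iff p A (fun _ => False)

/-! ### Disjoint finite sets of bounded size -/

/-- The probability that `A` is closed and each of finitely many disjoint sets contains an open
site, by induction on the number of sets: the failures of the last set enlarge `A`. -/
theorem setBernoulli_real_notMem_and_hit {ι : Type*} (p : unitInterval) (F : ℕ → Finset ι)
    (hF : Pairwise (fun i j => Disjoint (F i) (F j))) (m : ℕ) (A : Finset ι)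
    (hA : ∀ k < m, Disjoint A (F k)) :
    (setBernoulli (Set.univ : Set ι) p).real
      {ω | (∀ i ∈ A, i ∉ ω) ∧ ∀ k < m, ∃ i ∈ F k, i ∈ ω} =
      (1 - (p : ℝ)) ^ A.card * ∏ k ∈ Finset.range m, (1 - (1 - (p : ℝ)) ^ (F k).card) := by
  classical
  have hmeas : ∀ (m : ℕ) (A : Finset ι), MeasurableSet
      {ω : Set ι | (∀ i ∈ A, i ∉ ω) ∧ ∀ k < m, ∃ i ∈ F k, i ∈ ω} := by
    intro m A
    have : {ω : Set ι | (∀ i ∈ A, i ∉ ω) ∧ ∀ k < m, ∃ i ∈ F k, i ∈ ω} =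
        (⋂ i ∈ A, {ω | i ∈ ω}ᶜ) ∩ ⋂ k ∈ Finset.range m, ⋃ i ∈ F k, {ω | i ∈ ω} := by
      ext ω; simp
    rw [this]
    exact (A.measurableSet_biInter fun i _ => (measurableSet_mem i).compl).inter
      ((Finset.range m).measurableSet_biInter fun k _ =>
        (F k).measurableSet_biUnion fun i _ => measurableSet_mem i)
  induction m generalizing A with
  | zero => simpa using setBernoulli_real_forall_notMem p A
  | succ m ih =>
    have hset : {ω : Set ι | (∀ i ∈ A, i ∉ ω) ∧ ∀ k < m + 1, ∃ i ∈ F k, i ∈ ω} =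
        {ω | (∀ i ∈ A, i ∉ ω) ∧ ∀ k < m, ∃ i ∈ F k, i ∈ ω} \
          {ω | (∀ i ∈ A ∪ F m, i ∉ ω) ∧ ∀ k < m, ∃ i ∈ F k, i ∈ ω} := by
      ext ω
      simp only [Set.mem_ofPred_eq, Set.mem_sdiff, Nat.forall_lt_succ_right, Finset.mem_union]
      grind
    have hdisj : ∀ k < m, Disjoint (A ∪ F m) (F k) := fun k hk =>
      Finset.disjoint_union_left.2 ⟨hA k (by omega), hF (by omega)⟩
    have hsub : {ω : Set ι | (∀ i ∈ A ∪ F m, i ∉ ω) ∧ ∀ k < m, ∃ i ∈ F k, i ∈ ω} ⊆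
        {ω | (∀ i ∈ A, i ∉ ω) ∧ ∀ k < m, ∃ i ∈ F k, i ∈ ω} :=
      fun ω hω => ⟨fun i hi => hω.1 i (Finset.mem_union_left _ hi), hω.2⟩
    rw [hset, measureReal_sdiff hsub (hmeas _ _), ih A (fun k hk => hA k (by omega)), ih _ hdisj,
      Finset.card_union_of_disjoint (hA m (by omega)), Finset.prod_range_succ]
    ring

/-- Below density one, almost surely infinitely many members of a sequence of disjoint finite sets
of bounded size are completely closed. -/
theorem setBernoulli_eventually_hit_eq_zero {ι : Type*} (p : unitInterval) (hp : (p : ℝ) < 1)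
    (F : ℕ → Finset ι) (hF : Pairwise (fun i j => Disjoint (F i) (F j))) (N : ℕ)
    (hN : ∀ k, (F k).card ≤ N) :
    setBernoulli (Set.univ : Set ι) p {ω | ∃ K, ∀ k ≥ K, ∃ i ∈ F k, i ∈ ω} = 0 := by
  have hset : {ω : Set ι | ∃ K, ∀ k ≥ K, ∃ i ∈ F k, i ∈ ω} =
      ⋃ K, {ω | ∀ k ≥ K, ∃ i ∈ F k, i ∈ ω} := by ext; simp
  rw [hset, measure_iUnion_null_iff]
  intro K
  set r : ℝ := 1 - (1 - (p : ℝ)) ^ N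
  have hq0 : 0 < 1 - (p : ℝ) := by linarith
  have hq1 : 1 - (p : ℝ) ≤ 1 := by linarith [p.2.1]
  have hr0 : 0 ≤ r := sub_nonneg.2 (pow_le_one₀ hq0.le hq1)
  have hr1 : r < 1 := sub_lt_self _ (pow_pos hq0 _)
  have hle : ∀ m : ℕ, (setBernoulli (Set.univ : Set ι) p).real
      {ω | ∀ k ≥ K, ∃ i ∈ F k, i ∈ ω} ≤ r ^ m := by
    intro m
    have h := setBernoulli_real_notMem_and_hit p (fun k => F (K + k))
      (fun i j hij => hF (by omega)) m ∅ (by simp)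
    simp only [Finset.notMem_empty, false_imp_iff, implies_true, true_and, Finset.card_empty,
      pow_zero, one_mul] at h
    have hsub : {ω : Set ι | ∀ k ≥ K, ∃ i ∈ F k, i ∈ ω} ⊆
        {ω | ∀ k < m, ∃ i ∈ F (K + k), i ∈ ω} := fun ω hω k _ => hω (K + k) (by omega)
    calc _ ≤ _ := measureReal_mono hsub
      _ = _ := h
      _ ≤ ∏ k ∈ Finset.range m, r := by
        refine Finset.prod_le_prod (fun k _ => sub_nonneg.2 (pow_le_one₀ hq0.le hq1)) fun k _ => ?_
        exact sub_le_sub_left (pow_le_pow_of_le_one hq0.le hq1 (hN _)) _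
      _ = r ^ m := by simp
  have h0 : (setBernoulli (Set.univ : Set ι) p).real {ω | ∀ k ≥ K, ∃ i ∈ F k, i ∈ ω} ≤ 0 :=
    ge_of_tendsto' (tendsto_pow_atTop_nhds_zero_of_lt_one hr0 hr1) hle
  exact (measureReal_eq_zero_iff).1 (le_antisymm h0 measureReal_nonneg)

/-! ### Graphs with finite slabs do not percolate -/

theorem exists_adj_of_reachable {W : Type*} {K : SimpleGraph W} (h : W → ℤ) (c : ℤ) {x y : W}
    (hxy : K.Reachable x y) (hx : h x < c) (hy : c ≤ h y) :
    ∃ u v, K.Adj u v ∧ h u < c ∧ c ≤ h v := by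
  obtain ⟨w⟩ := hxy
  induction w with
  | nil => omega
  | cons hadj w ih =>
    rename_i u v z
    by_cases hv : h v < c
    · exact ih hv hy
    · exact ⟨u, v, hadj, hx, by omega⟩

/-- If a function on the vertices has finite fibres, then an infinite cluster crosses all
sufficiently high levels, or all sufficiently low ones. -/
theorem HasInfiniteCluster.exists_crossings {W : Type u} {K : SimpleGraph W}
    (hK : HasInfiniteCluster K) (h : W → ℤ) (hfin : ∀ a b : ℤ, {x | a ≤ h x ∧ h x ≤ b}.Finite) :
    (∃ C, ∀ c ≥ C, ∃ u v, K.Adj u v ∧ h u < c ∧ c ≤ h v) ∨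
      (∃ C, ∀ c ≥ C, ∃ u v, K.Adj u v ∧ -h u < c ∧ c ≤ -h v) := by
  obtain ⟨comp, hinf⟩ := hK
  obtain ⟨x, hx⟩ := hinf.nonempty
  have hreach : ∀ y ∈ comp.supp, K.Reachable x y := fun y hy =>
    SimpleGraph.ConnectedComponent.exact (hx.trans hy.symm)
  by_cases hub : ∀ c, ∃ y ∈ comp.supp, c ≤ h y
  · refine Or.inl ⟨h x + 1, fun c hc => ?_⟩
    obtain ⟨y, hy, hcy⟩ := hub c
    exact exists_adj_of_reachable h c (hreach y hy) (by omega) hcy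
  by_cases hlb : ∀ c, ∃ y ∈ comp.supp, c ≤ -h y
  · refine Or.inr ⟨-h x + 1, fun c hc => ?_⟩
    obtain ⟨y, hy, hcy⟩ := hlb c
    exact exists_adj_of_reachable (fun z => -h z) c (hreach y hy) (by omega) hcy
  push Not at hub hlb
  obtain ⟨b, hb⟩ := hub
  obtain ⟨a, ha⟩ := hlb
  refine absurd ((hfin (-a) b).subset fun y hy => ?_) hinf
  exact ⟨by linarith [ha y hy], (hb y hy).le⟩

/-- Let `lev i c` mean that the site or bond `i` can cross the level `c`. If a level is crossed by
at most `N` of them, and none crosses two levels at distance `M` or more, then below density one it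
almost surely does not happen that all high levels are crossed by open ones. -/
theorem setBernoulli_crossings_eq_zero {ι : Type*} (p : unitInterval) (hp : (p : ℝ) < 1)
    (lev : ι → ℤ → Prop) (M : ℤ) (hM : 0 < M) (N : ℕ)
    (hfin : ∀ c, {i | lev i c}.Finite) (hN : ∀ c, {i | lev i c}.ncard ≤ N)
    (hlev : ∀ i c c', lev i c → lev i c' → |c - c'| < M) :
    setBernoulli (Set.univ : Set ι) p {ω | ∃ C, ∀ c ≥ C, ∃ i ∈ ω, lev i c} = 0 := by
  refine measure_mono_null ?_ (setBernoulli_eventually_hit_eq_zero p hp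
    (fun k : ℕ => (hfin (M * k)).toFinset) ?_ N ?_)
  · rintro ω ⟨C, hC⟩
    refine ⟨C.toNat, fun k hk => ?_⟩
    obtain ⟨i, hi, hl⟩ := hC (M * k) (by
      have : C ≤ k := by omega
      nlinarith)
    exact ⟨i, by simpa using hl, hi⟩
  · intro j k hjk
    rw [Finset.disjoint_left]
    intro i hi hi'
    have := hlev i _ _ (by simpa using hi) (by simpa using hi')
    rw [← mul_sub, abs_mul, abs_of_pos hM] at this
    have h1 : 1 ≤ |(j : ℤ) - k| := Int.one_le_abs (by omega)
    nlinarith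
  · intro k
    rw [← Set.ncard_eq_toFinset_card _ (hfin _)]
    exact hN _

/-- `h` is a height function on `G` with slabs of bounded size: every edge changes it by less than
`M`, and at most `N` vertices lie in any open interval of length `2 * M`. -/
structure HasThinSlabs {V : Type u} (G : SimpleGraph V) (h : V → ℤ) (M : ℤ) (N : ℕ) : Prop where
  pos : 0 < M
  adj : ∀ x y, G.Adj x y → |h x - h y| < M
  finite : ∀ c, {x | |h x - c| < M}.Finite
  ncard : ∀ c, {x | |h x - c| < M}.ncard ≤ N

theorem HasThinSlabs.neg {V : Type u} {G : SimpleGraph V} {h : V → ℤ} {M : ℤ} {N : ℕ}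
    (H : HasThinSlabs G h M N) : HasThinSlabs G (fun x => -h x) M N where
  pos := H.pos
  adj x y hxy := by
    have := H.adj x y hxy
    rw [abs_lt] at *
    omega
  finite c := by
    convert H.finite (-c) using 4 with x
    rw [← abs_neg]; congr 1; ring
  ncard c := by
    convert H.ncard (-c) using 5 with x
    rw [← abs_neg]; congr 1; ring

theorem HasThinSlabs.finite_Icc {V : Type u} {G : SimpleGraph V} {h : V → ℤ} {M : ℤ} {N : ℕ}
    (H : HasThinSlabs G h M N) (a b : ℤ) : {x | a ≤ h x ∧ h x ≤ b}.Finite := by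
  refine ((Set.finite_Icc a b).biUnion fun c _ => H.finite c).subset fun x hx => ?_
  simp only [Set.mem_iUnion]
  exact ⟨h x, hx, by simpa using H.pos⟩

/-- For site percolation below density one, almost surely some arbitrarily high levels are not
crossed by open edges. -/
theorem HasThinSlabs.site_crossings {V : Type u} {G : SimpleGraph V} {h : V → ℤ} {M : ℤ} {N : ℕ}
    (H : HasThinSlabs G h M N) (p : unitInterval) (hp : (p : ℝ) < 1) :
    setBernoulli (Set.univ : Set V) p
      {ω | ∃ C, ∀ c ≥ C, ∃ u v, (G.induce ω).Adj u v ∧ h u < c ∧ c ≤ h v} = 0 := by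
  refine measure_mono_null ?_ (setBernoulli_crossings_eq_zero p hp
    (fun x c => c ≤ h x ∧ h x < c + M) M H.pos N ?_ ?_ ?_)
  · rintro ω ⟨C, hC⟩
    refine ⟨C, fun c hc => ?_⟩
    obtain ⟨u, v, huv, h1, h2⟩ := hC c hc
    have := H.adj u v huv
    rw [abs_lt] at this
    exact ⟨v, v.2, h2, by omega⟩
  · intro c
    exact (H.finite c).subset fun x hx => by simp only [Set.mem_ofPred_eq, abs_lt] at *; omega
  · intro c
    refine (Set.ncard_le_ncard (fun x hx => ?_) (H.finite c)).trans (H.ncard c)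
    simp only [Set.mem_ofPred_eq, abs_lt] at *; omega
  · rintro x c c' h1 h2
    rw [abs_lt]; omega

/-- For bond percolation below density one, almost surely some arbitrarily high levels are not
crossed by open edges. -/
theorem HasThinSlabs.bond_crossings {V : Type u} {G : SimpleGraph V} {h : V → ℤ} {M : ℤ} {N : ℕ}
    (H : HasThinSlabs G h M N) (p : unitInterval) (hp : (p : ℝ) < 1) :
    setBernoulli (Set.univ : Set G.edgeSet) p
      {ω | ∃ C, ∀ c ≥ C, ∃ u v, (SimpleGraph.fromEdgeSet (Subtype.val '' ω)).Adj u v ∧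
        h u < c ∧ c ≤ h v} = 0 := by
  classical
  set lev : G.edgeSet → ℤ → Prop := fun e c => ∃ u v, (e : Sym2 V) = s(u, v) ∧ h u < c ∧ c ≤ h v
  have hadj : ∀ (e : G.edgeSet) u v, (e : Sym2 V) = s(u, v) → |h u - h v| < M := by
    intro e u v he
    have := e.2
    rw [he, SimpleGraph.mem_edgeSet] at this
    exact H.adj u v this
  have himage : ∀ c, Subtype.val '' {e : G.edgeSet | lev e c} ⊆
      (fun q : V × V => s(q.1, q.2)) '' ({x | |h x - c| < M} ×ˢ {x | |h x - c| < M}) := by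
    rintro c _ ⟨e, ⟨u, v, he, h1, h2⟩, rfl⟩
    have := hadj e u v he
    refine ⟨(u, v), ⟨?_, ?_⟩, he.symm⟩ <;> simp only [Set.mem_ofPred_eq, abs_lt] at * <;> omega
  have hfin2 : ∀ c, ((fun q : V × V => s(q.1, q.2)) ''
      ({x | |h x - c| < M} ×ˢ {x | |h x - c| < M})).Finite := fun c =>
    ((H.finite c).prod (H.finite c)).image _
  refine measure_mono_null ?_ (setBernoulli_crossings_eq_zero p hp lev (2 * M)
    (by linarith [H.pos]) (N * N) ?_ ?_ ?_)
  · rintro ω ⟨C, hC⟩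
    refine ⟨C, fun c hc => ?_⟩
    obtain ⟨u, v, huv, h1, h2⟩ := hC c hc
    rw [SimpleGraph.fromEdgeSet_adj] at huv
    obtain ⟨⟨e, he, hee⟩, -⟩ := huv
    exact ⟨e, he, u, v, hee, h1, h2⟩
  · intro c
    exact Set.Finite.of_finite_image ((hfin2 c).subset (himage c)) Subtype.val_injective.injOn
  · intro c
    rw [← Set.ncard_image_of_injective _ Subtype.val_injective]
    refine (Set.ncard_le_ncard (himage c) (hfin2 c)).trans ?_
    refine (Set.ncard_image_le ((H.finite c).prod (H.finite c))).trans ?_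
    rw [Set.ncard_prod]
    exact Nat.mul_le_mul (H.ncard c) (H.ncard c)
  · rintro e c c' ⟨u, v, he, h1, h2⟩ ⟨u', v', he', h1', h2'⟩
    have := hadj e u v he
    have hpos := H.pos
    rw [he, Sym2.eq_iff] at he'
    rw [abs_lt] at *
    rcases he' with ⟨rfl, rfl⟩ | ⟨rfl, rfl⟩ <;> omega

theorem HasThinSlabs.one_le_pcSite {V : Type u} {G : SimpleGraph V} {h : V → ℤ} {M : ℤ} {N : ℕ}
    (H : HasThinSlabs G h M N) : 1 ≤ pcSite G := by
  refine le_of_forall_lt_imp_le_of_dense fun x hx => ?_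
  by_cases hx0 : 0 ≤ x
  · refine le_csSup ⟨1, ?_⟩ ⟨⟨x, hx0, hx.le⟩, rfl, ?_⟩
    · rintro _ ⟨p, rfl, -⟩
      exact p.2.2
    · refine measure_mono_null (fun ω hω => ?_) (measure_union_null
        (H.site_crossings ⟨x, hx0, hx.le⟩ hx) (H.neg.site_crossings ⟨x, hx0, hx.le⟩ hx))
      exact HasInfiniteCluster.exists_crossings hω (fun v => h v) fun a b =>
        (H.finite_Icc a b).preimage Subtype.val_injective.injOn
  · refine (not_le.1 hx0).le.trans (Real.sSup_nonneg ?_)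
    rintro _ ⟨p, rfl, -⟩
    exact p.2.1

theorem HasThinSlabs.one_le_pcBond {V : Type u} {G : SimpleGraph V} {h : V → ℤ} {M : ℤ} {N : ℕ}
    (H : HasThinSlabs G h M N) : 1 ≤ pcBond G := by
  refine le_of_forall_lt_imp_le_of_dense fun x hx => ?_
  by_cases hx0 : 0 ≤ x
  · refine le_csSup ⟨1, ?_⟩ ⟨⟨x, hx0, hx.le⟩, rfl, ?_⟩
    · rintro _ ⟨p, rfl, -⟩
      exact p.2.2
    · refine measure_mono_null (fun ω hω => ?_) (measure_union_null
        (H.bond_crossings ⟨x, hx0, hx.le⟩ hx) (H.neg.bond_crossings ⟨x, hx0, hx.le⟩ hx))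
      exact HasInfiniteCluster.exists_crossings hω h H.finite_Icc
  · refine (not_le.1 hx0).le.trans (Real.sSup_nonneg ?_)
    rintro _ ⟨p, rfl, -⟩
    exact p.2.1

/-! ### Nilpotent groups with at most one independent homomorphism to the integers -/

/-- Any two homomorphisms from `G` to `ℤ` are linearly dependent: all their `2 × 2` minors
vanish. For a finitely generated group, the abelianization has torsion-free rank at most one. -/
def RankLeOne (G : Type*) [Group G] : Prop :=
  ∀ (α β : G →* Multiplicative ℤ) (g h : G),
    (α g).toAdd * (β h).toAdd = (α h).toAdd * (β g).toAdd

theorem RankLeOne.of_surjective {G H : Type*} [Group G] [Group H] (hG : RankLeOne G) (f : G →* H)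
    (hf : Function.Surjective f) : RankLeOne H := by
  intro α β g h
  obtain ⟨g, rfl⟩ := hf g
  obtain ⟨h, rfl⟩ := hf h
  exact hG (α.comp f) (β.comp f) g h

theorem finite_fiber_and_ncard_le {G H : Type*} [Group G] [Group H] (f : G →* H) [Finite f.ker]
    (y : H) : {x | f x = y}.Finite ∧ {x | f x = y}.ncard ≤ Nat.card f.ker := by
  by_cases hy : ∃ x₀, f x₀ = y
  · obtain ⟨x₀, rfl⟩ := hy
    have hsub : {x | f x = f x₀} ⊆ (fun z => x₀ * z) '' (f.ker : Set G) := by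
      intro x hx
      refine ⟨x₀⁻¹ * x, ?_, by simp⟩
      have hx' : f x = f x₀ := hx
      simp [MonoidHom.mem_ker, hx']
    have hfin : ((fun z => x₀ * z) '' (f.ker : Set G)).Finite :=
      (Set.toFinite (f.ker : Set G)).image _
    refine ⟨hfin.subset hsub, (Set.ncard_le_ncard hsub hfin).trans ?_⟩
    exact (Set.ncard_image_le (Set.toFinite _)).trans (Nat.card_coe_set_eq _).ge
  · have : {x | f x = y} = ∅ := by
      ext x; simpa using fun h => hy ⟨x, h⟩
    simp [this]

theorem RankLeOne.exists_finite_ker_of_commGroup {A : Type*} [CommGroup A] [Group.FG A]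
    (hA : RankLeOne A) : ∃ φ : A →* Multiplicative ℤ, Finite φ.ker := by
  classical
  obtain ⟨ι, j, _, _, p, hp, e, ⟨f⟩⟩ := CommGroup.equiv_free_prod_prod_multiplicative_zmod A
  have : ∀ i, NeZero (p i ^ e i) := fun i => ⟨pow_ne_zero _ (hp i).ne_zero⟩
  have : ∀ i, Finite (Multiplicative (ZMod (p i ^ e i))) := fun i =>
    inferInstanceAs (Finite (ZMod (p i ^ e i)))
  let coord : j → A →* Multiplicative ℤ := fun i =>
    (Pi.evalMonoidHom _ i).comp ((MonoidHom.fst _ _).comp f.toMonoidHom)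
  have hj : Subsingleton j := by
    refine ⟨fun i i' => by_contra fun hne => ?_⟩
    have h := hA (coord i) (coord i') (f.symm (Pi.mulSingle i (Multiplicative.ofAdd 1), 1))
      (f.symm (Pi.mulSingle i' (Multiplicative.ofAdd 1), 1))
    simp [coord, Pi.mulSingle_eq_of_ne hne, Pi.mulSingle_eq_of_ne' hne] at h
  refine ⟨∏ i, coord i, ?_⟩
  refine Finite.of_injective
    (fun x : (∏ i, coord i).ker => (f (x : A)).2) fun x y hxy => ?_
  have hz : ∀ x : (∏ i, coord i).ker, (f (x : A)).1 = 1 := by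
    rintro ⟨x, hx⟩
    funext i
    have : Unique j := ⟨⟨i⟩, fun _ => Subsingleton.elim _ _⟩
    rw [MonoidHom.mem_ker, Fintype.prod_unique, Subsingleton.elim default i] at hx
    exact hx
  exact Subtype.ext (f.injective (Prod.ext ((hz x).trans (hz y).symm) hxy))

theorem RankLeOne.exists_finite_ker_of_finite_commutator {G : Type*} [Group G] [Group.FG G]
    (hG : RankLeOne G) [Finite (commutator G)] :
    ∃ φ : G →* Multiplicative ℤ, Finite φ.ker := by
  have hsurj : Function.Surjective (Abelianization.of : G →* Abelianization G) :=
    QuotientGroup.mk_surjective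
  have : Group.FG (Abelianization G) := Group.fg_of_surjective hsurj
  obtain ⟨φ, hφ⟩ := (hG.of_surjective _ hsurj).exists_finite_ker_of_commGroup
  have : Finite (Abelianization.of : G →* Abelianization G).ker := by
    rw [Abelianization.ker_of]; infer_instance
  refine ⟨φ.comp Abelianization.of, ?_⟩
  refine (((Set.toFinite (φ.ker : Set (Abelianization G))).biUnion fun y _ =>
    (finite_fiber_and_ncard_le Abelianization.of y).1).subset (s := _) fun x hx => ?_).to_subtype
  simp only [Set.mem_iUnion]
  exact ⟨Abelianization.of x, hx, rfl⟩

/-- A commutator depends only on the classes of its entries modulo the centre. -/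
theorem finite_commutatorSet_of_finite_quotient_center {G : Type*} [Group G]
    [Finite (G ⧸ Subgroup.center G)] : Finite (commutatorSet G) := by
  refine ((Set.finite_range fun q : (G ⧸ Subgroup.center G) × (G ⧸ Subgroup.center G) =>
    q.1.out * q.2.out * q.1.out⁻¹ * q.2.out⁻¹).subset ?_).to_subtype
  rintro _ ⟨g, h, rfl⟩
  refine ⟨(g, h), ?_⟩
  obtain ⟨⟨a, ha⟩, ha'⟩ := QuotientGroup.mk_out_eq_mul (Subgroup.center G) g
  obtain ⟨⟨b, hb⟩, hb'⟩ := QuotientGroup.mk_out_eq_mul (Subgroup.center G) h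
  simp only at ha' hb'
  rw [Subgroup.mem_center_iff] at ha hb
  have h1 : g * a * (h * b) = g * h * b * a := by
    rw [mul_assoc g a, ← ha (h * b), ← mul_assoc, ← mul_assoc]
  simp only [ha', hb', commutatorElement_def]
  rw [h1]
  calc g * h * b * a * (g * a)⁻¹ * (h * b)⁻¹ = g * h * (b * g⁻¹) * b⁻¹ * h⁻¹ := by group
    _ = g * h * g⁻¹ * h⁻¹ := by rw [← hb]; group

/-- If `G ⧸ center G` maps to `ℤ` with finite kernel and `t` has nonzero image, then every element
of `G` commutes with a power of `t`: conjugation by a power `T` of `t` multiplies `g` by a central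
element `z`, and `z` is torsion because some power of `g` is, up to a power of `t`, central. -/
theorem exists_pow_commute {G : Type*} [Group G]
    (φ : G ⧸ Subgroup.center G →* Multiplicative ℤ) [Finite φ.ker] (t : G) (ht : φ t ≠ 1) (g : G) :
    ∃ k > 0, Commute (t ^ k) g := by
  set π : G →* G ⧸ Subgroup.center G := QuotientGroup.mk' _ with hπ
  have hcen : ∀ x, π x = 1 → ∀ y, y * x = x * y := fun x hx =>
    Subgroup.mem_center_iff.1 ((QuotientGroup.eq_one_iff _).1 hx)
  -- Some power of `t` commutes with `g` modulo the centre.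
  obtain ⟨m, hm, hcomm⟩ : ∃ m > 0, Commute (π t ^ m) (π g) := by
    obtain ⟨i, j, hij, he⟩ := Finite.exists_ne_map_eq_of_infinite
      (fun i : ℕ => (⟨π t ^ i * π g * (π t ^ i)⁻¹ * (π g)⁻¹, by simp [MonoidHom.mem_ker]⟩ : φ.ker))
    have he' := mul_right_cancel (congrArg Subtype.val he)
    wlog hlt : i < j generalizing i j
    · exact this j i hij.symm he.symm he'.symm (by omega)
    refine ⟨j - i, by omega, ?_⟩
    have hj : π t ^ j = π t ^ i * π t ^ (j - i) := by rw [← pow_add]; congr 1; omega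
    rw [hj] at he'
    simp only [mul_inv_rev, mul_assoc, mul_right_inj] at he'
    simp only [← mul_assoc] at he'
    have h2 := mul_right_cancel he'
    exact (eq_mul_inv_iff_mul_eq.1 h2).symm
  set T := t ^ m with hT
  set z := T * g * T⁻¹ * g⁻¹ with hz
  have hzc : ∀ y, y * z = z * y := hcen z (by
    rw [hz, map_mul, map_mul, map_mul, map_inv, map_inv, hT, map_pow, hcomm.eq]; group)
  have hconj : MulAut.conj T g = z * g := by rw [MulAut.conj_apply, hz]; group
  have hconjt : MulAut.conj T t = t := by rw [MulAut.conj_apply, hT]; group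
  set d := (φ (π t)).toAdd with hd
  set c := (φ (π g)).toAdd with hc
  have hd0 : d ≠ 0 := fun h => ht (Multiplicative.toAdd.injective h)
  have hzg : Commute z g := (hzc g).symm
  -- `n` lies in the kernel of `φ`, hence has a central power.
  set n := g ^ d * t ^ (-c) with hn
  have hnker : π n ∈ φ.ker := by
    rw [MonoidHom.mem_ker]
    apply Multiplicative.toAdd.injective
    simp [hn, ← hc, ← hd, mul_comm]
  obtain ⟨e, he0, he⟩ : ∃ e > 0, π n ^ e = 1 := by
    refine ⟨Nat.card φ.ker, Nat.card_pos, ?_⟩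
    have := pow_card_eq_one' (x := (⟨π n, hnker⟩ : φ.ker))
    exact congrArg Subtype.val this
  have hconjn : MulAut.conj T n = z ^ d * n := by
    rw [hn, map_mul, map_zpow, map_zpow, hconj, hconjt, hzg.mul_zpow, mul_assoc]
  have hzde : (z ^ d) ^ e = 1 := by
    have h1 : MulAut.conj T (n ^ e) = n ^ e := by
      rw [MulAut.conj_apply, hcen (n ^ e) (by rw [map_pow, he]) T]; group
    have h2 : Commute (z ^ d) n := Commute.zpow_left (hzc n).symm d
    rw [map_pow, hconjn, h2.mul_pow] at h1
    exact mul_eq_right.1 h1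
  have hzr : z ^ (d.natAbs * e) = 1 := by
    rw [← zpow_natCast, Nat.cast_mul, zpow_mul, zpow_natCast]
    rcases Int.natAbs_eq d with h | h
    · rwa [← h]
    · rw [show ((d.natAbs : ℕ) : ℤ) = -d by omega, zpow_neg, inv_pow, hzde, inv_one]
  have hiter : ∀ k : ℕ, MulAut.conj (T ^ k) g = z ^ k * g := by
    intro k
    induction k with
    | zero => simp
    | succ k ih =>
      have hconjz : MulAut.conj T z = z := by rw [MulAut.conj_apply, hzc]; group
      rw [pow_succ', map_mul, MulAut.mul_apply, ih, map_mul, map_pow, hconj, hconjz, pow_succ]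
      exact (mul_assoc _ _ _).symm
  refine ⟨m * (d.natAbs * e), Nat.mul_pos hm (Nat.mul_pos (Int.natAbs_pos.2 hd0) he0), ?_⟩
  have := hiter (d.natAbs * e)
  rw [hzr, one_mul, MulAut.conj_apply, hT, ← pow_mul] at this
  exact mul_inv_eq_iff_eq_mul.1 this

/-- If `G ⧸ center G` maps to `ℤ` with finite kernel, the map is trivial: some power of an element
with nonzero image would commute with all generators, hence be central. -/
theorem finite_quotient_center_of_finite_ker {G : Type*} [Group G] [Group.FG G]
    (φ : G ⧸ Subgroup.center G →* Multiplicative ℤ) [Finite φ.ker] :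
    Finite (G ⧸ Subgroup.center G) := by
  have htriv : ∀ t : G, φ t = 1 := by
    by_contra! h
    obtain ⟨t, ht⟩ := h
    choose k hk hcomm using exists_pow_commute φ t ht
    obtain ⟨S, hS⟩ := Group.fg_def.1 (inferInstance : Group.FG G)
    have hcen : t ^ (∏ s ∈ S, k s) ∈ Subgroup.center G := by
      rw [Subgroup.mem_center_iff]
      have hle : (⊤ : Subgroup G) ≤ Subgroup.centralizer {t ^ (∏ s ∈ S, k s)} := by
        rw [← hS, Subgroup.closure_le]
        intro s hs
        obtain ⟨l, hl⟩ := Finset.dvd_prod_of_mem k hs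
        rw [SetLike.mem_coe, Subgroup.mem_centralizer_singleton_iff, hl, pow_mul]
        exact ((hcomm s).pow_left l).eq.symm
      exact fun g => Subgroup.mem_centralizer_singleton_iff.1 (hle (Subgroup.mem_top g))
    have h1 : φ (t : G ⧸ Subgroup.center G) ^ (∏ s ∈ S, k s) = 1 := by
      rw [← map_pow, ← QuotientGroup.mk_pow, (QuotientGroup.eq_one_iff _).2 hcen, map_one]
    have h2 : (∏ s ∈ S, k s) ≠ 0 := Finset.prod_ne_zero_iff.2 fun s _ => (hk s).ne'
    exact ht ((pow_eq_one_iff_left h2).1 h1)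
  refine Finite.of_injective (fun x => (⟨x, ?_⟩ : φ.ker)) fun x y h => congrArg Subtype.val h
  obtain ⟨t, rfl⟩ := QuotientGroup.mk_surjective x
  exact htriv t

/-- The induction runs through the quotients by the centre: if the quotient has a homomorphism to
`ℤ` with finite kernel, then it is finite, so the commutator subgroup is finite by Schur's
theorem. -/
theorem RankLeOne.exists_finite_ker {G : Type*} [Group G] [hn : Group.IsNilpotent G] [Group.FG G]
    (hG : RankLeOne G) : ∃ φ : G →* Multiplicative ℤ, Finite φ.ker := by
  rename_i hfg
  refine Group.nilpotent_center_quotient_ind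
    (P := fun G _ _ => Group.FG G → RankLeOne G → ∃ φ : G →* Multiplicative ℤ, Finite φ.ker)
    G ?_ ?_ hfg hG
  · intro G _ _ _ _
    exact ⟨1, inferInstance⟩
  · intro G _ _ ih _ hG
    obtain ⟨φ, hφ⟩ := ih inferInstance
      (hG.of_surjective (QuotientGroup.mk' _) (QuotientGroup.mk'_surjective _))
    have := finite_quotient_center_of_finite_ker φ
    have : Finite (commutatorSet G) := finite_commutatorSet_of_finite_quotient_center
    exact hG.exists_finite_ker_of_finite_commutator

/-! ### Distances in Cayley graphs -/

section Cayley

variable {V : Type u} [Group V] {S : Set V}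

theorem reachable_mul_gen (x s : V) (hs : s ∈ S) :
    (SimpleGraph.mulCayley S).Reachable x (x * s) := by
  by_cases h : x = x * s
  · rw [← h]
  · exact SimpleGraph.Adj.reachable ((SimpleGraph.mulCayley_adj' S _ _).2 ⟨h, s, hs, Or.inl rfl⟩)

theorem mulCayley_connected (hS : Subgroup.closure S = ⊤) :
    (SimpleGraph.mulCayley S).Connected := by
  have h : ∀ g x : V, (SimpleGraph.mulCayley S).Reachable x (x * g) := by
    intro g
    have hg : g ∈ Subgroup.closure S := hS ▸ Subgroup.mem_top g
    induction hg using Subgroup.closure_induction with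
    | mem s hs => exact fun x => reachable_mul_gen x s hs
    | one => intro x; rw [mul_one]
    | mul a b _ _ ha hb => intro x; rw [← mul_assoc]; exact (ha x).trans (hb _)
    | inv a _ ha => intro x; simpa using (ha (x * a⁻¹)).symm
  exact ⟨fun x y => by simpa using h (x⁻¹ * y) x⟩

theorem dist_mul_gen_le (x s : V) (hs : s ∈ S) : (SimpleGraph.mulCayley S).dist x (x * s) ≤ 1 := by
  by_cases h : x = x * s
  · rw [← h]; simp
  · exact (SimpleGraph.dist_eq_one_iff_adj.2
      ((SimpleGraph.mulCayley_adj' S _ _).2 ⟨h, s, hs, Or.inl rfl⟩)).le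

theorem dist_mul_gen_zpow_le (hS : Subgroup.closure S = ⊤) (x s : V) (hs : s ∈ S) (k : ℤ) :
    (SimpleGraph.mulCayley S).dist x (x * s ^ k) ≤ k.natAbs := by
  have hconn := mulCayley_connected hS
  have hnat : ∀ (n : ℕ) (x : V), (SimpleGraph.mulCayley S).dist x (x * s ^ n) ≤ n := by
    intro n
    induction n with
    | zero => simp
    | succ n ih =>
      intro x
      rw [pow_succ, ← mul_assoc]
      exact hconn.dist_triangle.trans (add_le_add (ih x) (dist_mul_gen_le _ s hs))
  obtain ⟨n, rfl | rfl⟩ := k.eq_nat_or_neg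
  · simpa using hnat n x
  · have := hnat n (x * s ^ (-(n : ℤ)))
    rw [SimpleGraph.dist_comm]
    simpa using this

/-- A homomorphism to `ℤ` bounded by `N` on the generators is `N`-Lipschitz. -/
theorem abs_sub_le_mul_dist (hS : Subgroup.closure S = ⊤) (α : V →* Multiplicative ℤ) (N : ℤ)
    (hα : ∀ s ∈ S, |(α s).toAdd| ≤ N) (x y : V) :
    |(α x).toAdd - (α y).toAdd| ≤ N * (SimpleGraph.mulCayley S).dist x y := by
  obtain ⟨w, hw⟩ := ((mulCayley_connected hS).preconnected x y).exists_walk_length_eq_dist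
  rw [← hw]
  clear hw
  induction w with
  | nil => simp
  | @cons u v z hadj w ih =>
    have h1 : |(α u).toAdd - (α v).toAdd| ≤ N := by
      obtain ⟨-, s, hs, h | h⟩ := (SimpleGraph.mulCayley_adj' S _ _).1 hadj
      · rw [← h]; simpa using hα s hs
      · rw [h]; simpa using hα s hs
    calc _ ≤ |(α u).toAdd - (α v).toAdd| + |(α v).toAdd - (α z).toAdd| := abs_sub_le _ _ _
      _ ≤ N + N * w.length := add_le_add h1 ih
      _ = _ := by rw [SimpleGraph.Walk.length_cons]; push_cast; ring

/-- A homomorphism to `ℤ` with finite kernel is a height function with thin slabs on every Cayley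
graph. -/
theorem exists_hasThinSlabs (hfin : S.Finite) (φ : V →* Multiplicative ℤ)
    [Finite φ.ker] :
    ∃ M N, HasThinSlabs (SimpleGraph.mulCayley S) (fun x => (φ x).toAdd) M N := by
  obtain ⟨M, hM⟩ := (hfin.image fun s => |(φ s).toAdd|).bddAbove
  have hM' : ∀ s ∈ S, |(φ s).toAdd| < max M 0 + 1 := fun s hs => by
    have := hM (Set.mem_image_of_mem _ hs)
    have := le_max_left M 0
    omega
  set L := max M 0 + 1 with hL
  have hpos : 0 < L := by have := le_max_right M 0; omega
  have hsub : ∀ c : ℤ, {x | |(φ x).toAdd - c| < L} ⊆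
      ⋃ i ∈ Finset.Ioo (c - L) (c + L), {x | φ x = Multiplicative.ofAdd i} := by
    intro c x hx
    simp only [Set.mem_iUnion, Finset.mem_Ioo, Set.mem_ofPred_eq, abs_lt] at *
    exact ⟨(φ x).toAdd, by omega, rfl⟩
  have hf : ∀ c : ℤ, (⋃ i ∈ Finset.Ioo (c - L) (c + L),
      {x | φ x = Multiplicative.ofAdd i}).Finite := fun c =>
    (Finset.finite_toSet _).biUnion fun i _ => (finite_fiber_and_ncard_le φ _).1
  refine ⟨L, (2 * L).toNat * Nat.card φ.ker, hpos, ?_, fun c => (hf c).subset (hsub c), ?_⟩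
  · intro x y hxy
    obtain ⟨-, s, hs, h | h⟩ := (SimpleGraph.mulCayley_adj' S _ _).1 hxy
    · rw [← h]; simpa using hM' s hs
    · rw [h]; simpa using hM' s hs
  · intro c
    refine (Set.ncard_le_ncard (hsub c) (hf c)).trans ?_
    refine (Finset.set_ncard_biUnion_le _ _).trans ?_
    refine (Finset.sum_le_card_nsmul _ _ _ fun i _ => (finite_fiber_and_ncard_le φ _).2).trans ?_
    rw [Int.card_Ioo, smul_eq_mul]
    exact Nat.mul_le_mul_right _ (by omega)

theorem not_rankLeOne_of_pc_lt_one [Group.IsNilpotent V] (hfin : S.Finite)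
    (hS : Subgroup.closure S = ⊤)
    (hpc : pcSite (SimpleGraph.mulCayley S) < 1 ∨ pcBond (SimpleGraph.mulCayley S) < 1) :
    ¬ RankLeOne V := by
  intro hV
  have : Group.FG V := Group.fg_iff.2 ⟨S, hS, hfin⟩
  obtain ⟨φ, hφ⟩ := hV.exists_finite_ker
  obtain ⟨M, N, H⟩ := exists_hasThinSlabs hfin φ
  rcases hpc with h | h
  · exact h.not_ge H.one_le_pcSite
  · exact h.not_ge H.one_le_pcBond

/-- Two generators on which a minor is maximal in absolute value give coordinates in which every
generator has coordinates of absolute value at most one, after scaling by `N`. -/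
theorem exists_auerbach (hfin : S.Finite) (hS : Subgroup.closure S = ⊤) (hV : ¬ RankLeOne V) :
    ∃ (α β : V →* Multiplicative ℤ) (s t : V) (N : ℤ), s ∈ S ∧ t ∈ S ∧ 0 < N ∧
      (α s).toAdd = N ∧ (α t).toAdd = 0 ∧ (β s).toAdd = 0 ∧ (β t).toAdd = N ∧
      (∀ x ∈ S, |(α x).toAdd| ≤ N) ∧ ∀ x ∈ S, |(β x).toAdd| ≤ N := by
  simp only [RankLeOne, not_forall] at hV
  obtain ⟨α, β, g, h, hgh⟩ := hV
  -- `D x` is the homomorphism sending `y` to the minor of `x` and `y`.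
  let D : V → V →* Multiplicative ℤ := fun x => β ^ (α x).toAdd * (α ^ (β x).toAdd)⁻¹
  have hD : ∀ x y, (D x y).toAdd = (α x).toAdd * (β y).toAdd - (β x).toAdd * (α y).toAdd := by
    intro x y; simp [D, sub_eq_add_neg]
  have hanti : ∀ x y, (D x y).toAdd = -(D y x).toAdd := by intro x y; rw [hD, hD]; ring
  have hext : ∀ (χ : V →* Multiplicative ℤ), (∀ x ∈ S, χ x = 1) → χ = 1 := fun χ hχ =>
    MonoidHom.eq_of_eqOn_dense hS fun x hx => hχ x hx
  have hne : ∃ x ∈ S, ∃ y ∈ S, (D x y).toAdd ≠ 0 := by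
    by_contra! hcon
    have h1 : ∀ x ∈ S, D x = 1 := fun x hx => hext _ fun y hy =>
      Multiplicative.toAdd.injective (hcon x hx y hy)
    have h2 : D g = 1 := hext _ fun x hx => Multiplicative.toAdd.injective (by
      rw [hanti, h1 x hx]; simp)
    have h3 : (D g h).toAdd = 0 := by rw [h2]; simp
    rw [hD] at h3
    exact hgh (by linarith)
  obtain ⟨x₀, hx₀, y₀, hy₀, hne⟩ := hne
  obtain ⟨⟨s, t⟩, ⟨hs, ht⟩, hmax⟩ := Set.exists_max_image (S ×ˢ S) (fun q => |(D q.1 q.2).toAdd|)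
    (hfin.prod hfin) ⟨(x₀, y₀), hx₀, hy₀⟩
  have hmax' : ∀ x ∈ S, ∀ y ∈ S, |(D x y).toAdd| ≤ |(D s t).toAdd| := fun x hx y hy =>
    hmax (x, y) ⟨hx, hy⟩
  have hpos : 0 < |(D s t).toAdd| := (abs_pos.2 hne).trans_le (hmax' _ hx₀ _ hy₀)
  have hss : ∀ x, (D x x).toAdd = 0 := by intro x; rw [hD]; ring
  obtain ⟨ε, hε1, hεD⟩ : ∃ ε : ℤ, |ε| = 1 ∧ ε * (D s t).toAdd = |(D s t).toAdd| := by
    rcases abs_choice (D s t).toAdd with h | h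
    · exact ⟨1, by simp, by rw [h, one_mul]⟩
    · exact ⟨-1, by simp, by rw [h, neg_one_mul]⟩
  refine ⟨(D t)⁻¹ ^ ε, D s ^ ε, s, t, |(D s t).toAdd|, hs, ht, hpos, ?_, ?_, ?_, ?_, ?_, ?_⟩
  · simp only [MonoidHom.zpow_apply, MonoidHom.inv_apply, toAdd_zpow, toAdd_inv, ← hanti,
      smul_eq_mul, hεD]
  · simp [hss]
  · simp [hss]
  · simp [hεD]
  · intro x hx
    simpa [abs_mul, hε1] using (hmax' t ht x hx)
  · intro x hx
    simpa [abs_mul, hε1] using (hmax' s hs x hx)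

end Cayley

/-! ### Percolation on a graph and on its projections -/

/-- `Reached G ω o v`: there is a path from `o` to `v` in `G`, all of whose vertices (including both
ends) are in `ω`. -/
inductive Reached {V : Type*} (G : SimpleGraph V) (ω : Set V) (o : V) : V → Prop
  | base : o ∈ ω → Reached G ω o o
  | step {u v : V} : Reached G ω o u → G.Adj u v → v ∈ ω → Reached G ω o v

theorem Reached.mem {V : Type*} {G : SimpleGraph V} {ω : Set V} {o v : V}
    (h : Reached G ω o v) : v ∈ ω := by
  cases h <;> assumption

theorem Reached.mono {V : Type*} {G : SimpleGraph V} {ω ω' : Set V} {o v : V}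
    (h : Reached G ω o v) (hω : ω ⊆ ω') : Reached G ω' o v := by
  induction h with
  | base h => exact .base (hω h)
  | step _ hadj hv ih => exact .step ih hadj (hω hv)

theorem Reached.reachable {V : Type*} {G : SimpleGraph V} {ω : Set V} {o v : V}
    (h : Reached G ω o v) (ho : o ∈ ω) (hv : v ∈ ω) :
    (G.induce ω).Reachable ⟨o, ho⟩ ⟨v, hv⟩ := by
  induction h with
  | base h => exact .refl _
  | @step u v hu hadj hv' ih =>
    exact (ih hu.mem).trans (SimpleGraph.Adj.reachable (by simpa using hadj))

variable {V : Type u} {T : Type*} {H : SimpleGraph V} {Γ : SimpleGraph T} {π : V → T}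

/-- One stage of the exploration of the cluster of `o`: the sites of `A` have been explored, those
of `O` are open, `x` is the chosen lift of every explored site, and every lift of an open
explored site is joined to `o` through such lifts. -/
structure IsExploration (H : SimpleGraph V) (π : V → T) (o : V) (A O : Finset T) (x : T → V) :
    Prop where
  subset : O ⊆ A
  base : π o ∈ A ∧ x (π o) = o
  proj : ∀ w ∈ A, π (x w) = w
  reached : ∀ w ∈ O, Reached H (x '' O) o (x w)

/-- An exploration is extended by one site, closed or open. -/
theorem IsExploration.insert [DecidableEq T] {o : V} {A O : Finset T} {x : T → V}
    (hE : IsExploration H π o A O x) {u w : T} (hu : u ∈ O) (hw : w ∉ A) {x' : V}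
    (hadj : H.Adj (x u) x') (hx' : π x' = w) :
    IsExploration H π o (insert w A) O (Function.update x w x') ∧
      IsExploration H π o (insert w A) (insert w O) (Function.update x w x') := by
  have hne : ∀ v ∈ A, Function.update x w x' v = x v := fun v hv =>
    Function.update_of_ne (by rintro rfl; exact hw hv) _ _
  have himg : x '' O ⊆ Function.update x w x' '' O := by
    rintro _ ⟨v, hv, rfl⟩
    exact ⟨v, hv, hne v (hE.subset hv)⟩
  have hbase : π o ∈ Insert.insert w A ∧ Function.update x w x' (π o) = o :=
    ⟨Finset.mem_insert_of_mem hE.base.1, (hne _ hE.base.1).trans hE.base.2⟩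
  have hproj : ∀ v ∈ Insert.insert w A, π (Function.update x w x' v) = v := by
    intro v hv
    rcases Finset.mem_insert.1 hv with rfl | hv
    · simpa using hx'
    · rw [hne v hv, hE.proj v hv]
  have hreach : ∀ v ∈ O, Reached H (Function.update x w x' '' O) o
      (Function.update x w x' v) := fun v hv => by
    rw [hne v (hE.subset hv)]
    exact (hE.reached v hv).mono himg
  refine ⟨⟨hE.subset.trans (Finset.subset_insert _ _), hbase, hproj, hreach⟩,
    ⟨Finset.insert_subset_insert _ hE.subset, hbase, hproj, ?_⟩⟩
  have himg' : Function.update x w x' '' O ⊆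
      Function.update x w x' '' (Insert.insert w O : Finset T) :=
    Set.image_mono (by simp)
  intro v hv
  rcases Finset.mem_insert.1 hv with rfl | hv
  · refine .step ((hreach u hu).mono himg') ?_ ⟨v, by simp, rfl⟩
    rw [hne u (hE.subset hu), Function.update_self]
    exact hadj
  · exact (hreach v hv).mono himg'

/-- A site `y` splits an event into the parts where `y` is open and where `y` is closed. -/
theorem setBernoulli_real_split {ι : Type*} (p : unitInterval) (y : ι) (E : Set (Set ι)) :
    (setBernoulli (Set.univ : Set ι) p).real (E ∩ {ω | y ∈ ω}) +
      (setBernoulli (Set.univ : Set ι) p).real (E ∩ {ω | y ∉ ω}) =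
      (setBernoulli (Set.univ : Set ι) p).real E := by
  rw [← measureReal_inter_add_sdiff (s := E) (measurableSet_mem y)]
  rfl

theorem forall_mem_insert_iff_open [DecidableEq T] {ι : Type*} {A O : Finset T} {w : T}
    (hw : w ∉ A) {y y' : T → ι} (hy : ∀ v ∈ A, y' v = y v) (ω : Set ι) :
    (∀ v ∈ insert w A, (y' v ∈ ω ↔ v ∈ insert w O)) ↔ (∀ v ∈ A, (y v ∈ ω ↔ v ∈ O)) ∧ y' w ∈ ω := by
  simp only [Finset.mem_insert]
  grind

theorem forall_mem_insert_iff_closed [DecidableEq T] {ι : Type*} {A O : Finset T} {w : T}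
    (hw : w ∉ O) {y y' : T → ι} (hy : ∀ v ∈ A, y' v = y v) (ω : Set ι) :
    (∀ v ∈ insert w A, (y' v ∈ ω ↔ v ∈ O)) ↔ (∀ v ∈ A, (y v ∈ ω ↔ v ∈ O)) ∧ y' w ∉ ω := by
  simp only [Finset.mem_insert]
  grind

/-- The probability that the cluster of `o` stays above `B`, given any stage of its exploration,
is at most the corresponding probability on the base. This is proved by revealing one further site
at a time on both sides, until no unexplored site is adjacent to the explored cluster. -/
theorem IsExploration.real_bad_le [DecidableEq T] (p : unitInterval)
    (B B' : Finset T) (hB : ∀ u ∈ B, ∀ w, Γ.Adj u w → w ∈ B')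
    (hlift : ∀ x w, Γ.Adj (π x) w → ∃ x', H.Adj x x' ∧ π x' = w) (o : V) (m : ℕ) :
    ∀ (A O : Finset T) (x : T → V), IsExploration H π o A O x → (B' \ A).card < m →
      (setBernoulli (Set.univ : Set V) p).real
        ({ω | ∀ w ∈ A, (x w ∈ ω ↔ w ∈ O)} ∩ {ω | ∀ v, Reached H ω o v → π v ∈ B}) ≤
      (setBernoulli (Set.univ : Set T) p).real
        ({η | ∀ w ∈ A, (w ∈ η ↔ w ∈ O)} ∩ {η | ∀ w, Reached Γ η (π o) w → w ∈ B}) := by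
  induction m with
  | zero => intro A O x _ h; exact absurd h (Nat.not_lt_zero _)
  | succ m ih =>
  intro A O x hE hm
  by_cases hOB : O ⊆ B
  swap
  · obtain ⟨w, hwO, hwB⟩ := Finset.not_subset.1 hOB
    have hempty : {ω | ∀ w ∈ A, (x w ∈ ω ↔ w ∈ O)} ∩ {ω | ∀ v, Reached H ω o v → π v ∈ B} = ∅ := by
      ext ω
      simp only [Set.mem_inter_iff, Set.mem_ofPred_eq, Set.mem_empty_iff_false, iff_false, not_and]
      intro hC hbad
      have hsub : x '' O ⊆ ω := by
        rintro _ ⟨v, hv, rfl⟩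
        exact (hC v (hE.subset hv)).2 hv
      exact hwB (hE.proj w (hE.subset hwO) ▸ hbad _ ((hE.reached w hwO).mono hsub))
    rw [hempty, measureReal_empty]
    exact measureReal_nonneg
  by_cases hex : ∃ u ∈ O, ∃ w, Γ.Adj u w ∧ w ∉ A
  swap
  · push Not at hex
    have hC : {η : Set T | ∀ w ∈ A, (w ∈ η ↔ w ∈ O)} ∩ {η | ∀ w, Reached Γ η (π o) w → w ∈ B} =
        {η | ∀ w ∈ A, (w ∈ η ↔ w ∈ O)} := by
      refine Set.inter_eq_left.2 fun η hη w hw => hOB ?_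
      induction hw with
      | base h => exact (hη _ hE.base.1).1 h
      | step _ hadj hv ih => exact (hη _ (hex _ ih _ hadj)).1 hv
    rw [hC, setBernoulli_real_forall_mem_iff p A (· ∈ O)]
    refine (measureReal_mono Set.inter_subset_left).trans_eq ?_
    exact setBernoulli_real_forall_mem_iff_of_injOn p A x
      (Set.LeftInvOn.injOn (f₁' := π) hE.proj) (· ∈ O)
  obtain ⟨u, hu, w, hadj, hw⟩ := hex
  obtain ⟨x', hx', hπ⟩ := hlift (x u) w (by rwa [hE.proj u (hE.subset hu)])
  obtain ⟨hE0, hE1⟩ := hE.insert hu hw hx' hπ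
  have hne : ∀ v ∈ A, Function.update x w x' v = x v := fun v hv =>
    Function.update_of_ne (by rintro rfl; exact hw hv) _ _
  have hcard : (B' \ Insert.insert w A).card < m := by
    have : (B' \ Insert.insert w A).card < (B' \ A).card := by
      refine Finset.card_lt_card ⟨Finset.sdiff_subset_sdiff le_rfl (Finset.subset_insert _ _), ?_⟩
      intro h
      have := h (Finset.mem_sdiff.2 ⟨hB u (hOB hu) w hadj, hw⟩)
      simp at this
    omega
  have hwO : w ∉ O := fun h => hw (hE.subset h)
  rw [← setBernoulli_real_split p x', ← setBernoulli_real_split p w]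
  have h1 := ih _ _ _ hE1 hcard
  have h0 := ih _ _ _ hE0 hcard
  refine add_le_add ((measureReal_mono ?_).trans (h1.trans (measureReal_mono ?_)))
    ((measureReal_mono ?_).trans (h0.trans (measureReal_mono ?_)))
  · rintro ω ⟨⟨hC, hbad⟩, hopen⟩
    exact ⟨(forall_mem_insert_iff_open hw hne ω).2 ⟨hC, by simpa using hopen⟩, hbad⟩
  · rintro η ⟨hC, hbad⟩
    obtain ⟨hC, hopen⟩ := (forall_mem_insert_iff_open (y := id) hw (fun _ _ => rfl) η).1 hC
    exact ⟨⟨hC, hbad⟩, hopen⟩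
  · rintro ω ⟨⟨hC, hbad⟩, hclosed⟩
    exact ⟨(forall_mem_insert_iff_closed hwO hne ω).2 ⟨hC, by simpa using hclosed⟩, hbad⟩
  · rintro η ⟨hC, hbad⟩
    obtain ⟨hC, hclosed⟩ := (forall_mem_insert_iff_closed (y := id) hwO (fun _ _ => rfl) η).1 hC
    exact ⟨⟨hC, hbad⟩, hclosed⟩

/-- If the steps of `Γ` lift to `H`, then the open cluster of `o` in `H` is at least as likely to
leave the part of `H` above a finite set `B` as the open cluster of the projection of `o` is to
leave `B`. -/
theorem real_reached_subset_le [DecidableEq T] (p : unitInterval)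
    (B B' : Finset T) (hB : ∀ u ∈ B, ∀ w, Γ.Adj u w → w ∈ B')
    (hlift : ∀ x w, Γ.Adj (π x) w → ∃ x', H.Adj x x' ∧ π x' = w) (o : V) :
    (setBernoulli (Set.univ : Set V) p).real {ω | ∀ v, Reached H ω o v → π v ∈ B} ≤
      (setBernoulli (Set.univ : Set T) p).real {η | ∀ w, Reached Γ η (π o) w → w ∈ B} := by
  have hE0 : IsExploration H π o {π o} ∅ (fun _ => o) :=
    ⟨by simp, by simp, by simp, by simp⟩
  have hE1 : IsExploration H π o {π o} {π o} (fun _ => o) := by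
    refine ⟨by simp, by simp, by simp, ?_⟩
    intro w _
    exact .base ⟨π o, by simp, rfl⟩
  have h0 := hE0.real_bad_le p B B' hB hlift o _ _ _ _ (Nat.lt_succ_self _)
  have h1 := hE1.real_bad_le p B B' hB hlift o _ _ _ _ (Nat.lt_succ_self _)
  rw [← setBernoulli_real_split p o, ← setBernoulli_real_split p (π o)]
  simp only [Finset.mem_singleton, forall_eq, Finset.notMem_empty, iff_false, iff_true] at h0 h1
  rw [Set.inter_comm _ {ω | o ∈ ω}, Set.inter_comm _ {ω | o ∉ ω}, Set.inter_comm _ {η | π o ∈ η},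
    Set.inter_comm _ {η | π o ∉ η}]
  exact add_le_add h1 h0

/-! ### The triangular lattice and its interfaces -/

/-- The six unit vectors of the triangular lattice, realized on `ℤ × ℤ`. -/
def triDirs : Finset (ℤ × ℤ) := {(1, 0), (0, 1), (-1, 1), (-1, 0), (0, -1), (1, -1)}

/-- Rotation of the triangular lattice by sixty degrees. -/
def rot (d : ℤ × ℤ) : ℤ × ℤ := (-d.2, d.1 + d.2)

/-- The inverse of `rot`. -/
def rotInv (d : ℤ × ℤ) : ℤ × ℤ := (d.1 + d.2, -d.1)

theorem rot_mem : ∀ d ∈ triDirs, rot d ∈ triDirs := by decide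
theorem rotInv_mem : ∀ d ∈ triDirs, rotInv d ∈ triDirs := by decide
theorem rot_sub_mem : ∀ d ∈ triDirs, rot d - d ∈ triDirs := by decide
theorem neg_mem_triDirs : ∀ d ∈ triDirs, -d ∈ triDirs := by decide
theorem ne_zero_of_mem_triDirs : ∀ d ∈ triDirs, d ≠ 0 := by decide
theorem abs_fst_le_one : ∀ d ∈ triDirs, |d.1| ≤ 1 := by decide
theorem abs_snd_le_one : ∀ d ∈ triDirs, |d.2| ≤ 1 := by decide

/-- The triangular lattice in the upper half-plane. The vertices below the half-plane are kept, as
isolated vertices. -/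
def halfTri : SimpleGraph (ℤ × ℤ) where
  Adj u v := 0 ≤ u.2 ∧ 0 ≤ v.2 ∧ v - u ∈ triDirs
  symm := ⟨fun u v h => ⟨h.2.1, h.1, by simpa using neg_mem_triDirs _ h.2.2⟩⟩
  loopless := ⟨fun u h => ne_zero_of_mem_triDirs _ h.2.2 (sub_self u)⟩

/-- The interface step: `(u, d)` stands for the edge from `u` to `u + d`, and the step turns it
around the triangle on its left so that the new edge still leaves `A`. -/
def interfaceStep (A : Set (ℤ × ℤ)) [DecidablePred (· ∈ A)] (e : (ℤ × ℤ) × (ℤ × ℤ)) :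
    (ℤ × ℤ) × (ℤ × ℤ) :=
  if e.1 + rot e.2 ∈ A then (e.1 + rot e.2, rotInv e.2) else (e.1, rot e.2)

/-- `(u, d)` is a boundary edge of `A`: it leads from `u ∈ A` to `u + d ∉ A`. -/
def IsBoundaryEdge (A : Set (ℤ × ℤ)) (e : (ℤ × ℤ) × (ℤ × ℤ)) : Prop :=
  e.2 ∈ triDirs ∧ e.1 ∈ A ∧ e.1 + e.2 ∉ A

theorem add_rot_add_rotInv (u d : ℤ × ℤ) : u + rot d + rotInv d = u + d := by
  ext <;> simp [rot, rotInv] <;> ring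

theorem IsBoundaryEdge.interfaceStep {A : Set (ℤ × ℤ)} [DecidablePred (· ∈ A)]
    {e : (ℤ × ℤ) × (ℤ × ℤ)} (he : IsBoundaryEdge A e) : IsBoundaryEdge A (interfaceStep A e) := by
  unfold NilpotentNets.interfaceStep
  split_ifs with h
  · exact ⟨rotInv_mem _ he.1, h, by simpa only [add_rot_add_rotInv] using he.2.2⟩
  · exact ⟨rot_mem _ he.1, he.2.1, h⟩

/-- The interface step is reversible: whether `A` contains the third vertex of the triangle on the
right of the new edge tells which of the two kinds of step was made. -/
theorem interfaceStep_injOn (A : Set (ℤ × ℤ)) [DecidablePred (· ∈ A)] :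
    Set.InjOn (interfaceStep A) {e | IsBoundaryEdge A e} := by
  rintro ⟨u, d⟩ he ⟨u', d'⟩ he' h
  have hu : u ∈ A := he.2.1
  have hu' : u' ∈ A := he'.2.1
  have hv : u + d ∉ A := he.2.2
  have hv' : u' + d' ∉ A := he'.2.2
  have key : ∀ u d u' d' : ℤ × ℤ, u + rot d = u' → rotInv d = rot d' → u = u' + d' := by
    rintro u d u' d' rfl h
    simp only [rot, rotInv, Prod.mk.injEq] at h
    ext <;> simp [rot] <;> omega
  unfold interfaceStep at h
  simp only at h
  split_ifs at h with h1 h2 h2 <;> simp only [Prod.mk.injEq] at h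
  · have hd : d = d' := by
      have := h.2
      simp only [rotInv, Prod.mk.injEq] at this
      ext <;> omega
    subst hd
    simpa using h.1
  · exact absurd (key _ _ _ _ h.1 h.2 ▸ hu) hv'
  · exact absurd (key _ _ _ _ h.1.symm h.2.symm ▸ hu') hv
  · have hd : d = d' := by
      have := h.2
      simp only [rot, Prod.mk.injEq] at this
      ext <;> omega
    rw [hd, h.1]

/-- The outer boundary, in the half-plane, of a finite set containing the segment from `(-R, 0)` to
`(R, 0)` joins the two parts of the bottom line outside the segment: the interface that enters along
the bottom line from the far right cannot return to the right or be trapped, because interface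
steps are injective, so it leaves to the left. -/
theorem exists_boundary_crossing (A : Set (ℤ × ℤ)) (hfin : A.Finite)
    (R : ℤ) (hR : 0 < R) (hseg : ∀ i : ℤ, |i| ≤ R → (i, (0 : ℤ)) ∈ A) :
    ∃ z z' : ℤ × ℤ, z.2 = 0 ∧ R < z.1 ∧ z'.2 = 0 ∧ z'.1 < -R ∧
      Reached halfTri {v | 0 ≤ v.2 ∧ v ∉ A ∧ ∃ u ∈ A, v - u ∈ triDirs} z z' := by
  classical
  set Z : Set (ℤ × ℤ) := {v | 0 ≤ v.2 ∧ v ∉ A ∧ ∃ u ∈ A, v - u ∈ triDirs} with hZ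
  obtain ⟨L, hL⟩ : ∃ L : ℤ, ∀ u ∈ A, |u.1| < L := by
    obtain ⟨L, hL⟩ := (hfin.image fun u => |u.1|).bddAbove
    exact ⟨L + 1, fun u hu => Int.lt_add_one_iff.2 (hL (Set.mem_image_of_mem _ hu))⟩
  set A' : Set (ℤ × ℤ) := A ∪ {u | u.2 < 0} with hA'
  have hnotA : ∀ x : ℤ, L ≤ x → (x, (0 : ℤ)) ∉ A' := by
    rintro x hx (h | h)
    · have := hL _ h
      rw [abs_lt] at this
      simp only at this
      omega
    · exact absurd h (by simp)
  have hbelow : ∀ x : ℤ, (x, (-1 : ℤ)) ∈ A' := fun x => Or.inr (by simp)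
  -- The edges of the bottom line to the right of the starting edge.
  set Right : Set ((ℤ × ℤ) × (ℤ × ℤ)) :=
    {e | ∃ x > L, e = ((x, -1), (0, 1)) ∨ e = ((x, -1), (-1, 1))} with hRight
  have hbd0 : ∀ x ≥ L, IsBoundaryEdge A' ((x, -1), (0, 1)) := fun x hx =>
    ⟨by simp [triDirs], hbelow x, by simpa using hnotA x hx⟩
  have hbd1 : ∀ x > L, IsBoundaryEdge A' ((x, -1), (-1, 1)) := fun x hx =>
    ⟨by simp [triDirs], hbelow x, by simpa using hnotA (x + -1) (by omega)⟩
  have hstep0 : ∀ x > L, interfaceStep A' ((x, -1), (0, 1)) = ((x, -1), (-1, 1)) := by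
    intro x hx
    have : (x, (-1 : ℤ)) + rot (0, 1) ∉ A' := by simpa [rot] using hnotA (x + -1) (by omega)
    simp only [interfaceStep, if_neg this]
    simp [rot]
  have hstep1 : ∀ x : ℤ, interfaceStep A' ((x + 1, -1), (-1, 1)) = ((x, -1), (0, 1)) := by
    intro x
    have h1 : (x + 1, (-1 : ℤ)) + rot (-1, 1) = (x, -1) := by simp [rot]
    simp only [interfaceStep, h1, if_pos (hbelow x)]
    simp [rotInv]
  set e : ℕ → (ℤ × ℤ) × (ℤ × ℤ) := fun k => (interfaceStep A')^[k] ((L, -1), (0, 1)) with he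
  have hesucc : ∀ k, e (k + 1) = interfaceStep A' (e k) := fun k =>
    Function.iterate_succ_apply' _ _ _
  have hebd : ∀ k, IsBoundaryEdge A' (e k) := by
    intro k
    induction k with
    | zero => exact hbd0 L le_rfl
    | succ k ih => rw [hesucc]; exact ih.interfaceStep
  have hright : ∀ k, e k ∉ Right := by
    intro k
    induction k with
    | zero =>
      rintro ⟨x, hx, h | h⟩ <;> simp [he] at h
      omega
    | succ k ih =>
      rintro ⟨x, hx, h | h⟩
      · rw [hesucc, ← hstep1] at h
        have := interfaceStep_injOn A' (hebd k) (hbd1 (x + 1) (by omega)) h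
        exact ih ⟨x + 1, by omega, Or.inr this⟩
      · rw [hesucc, ← hstep0 x hx] at h
        exact ih ⟨x, hx, Or.inl (interfaceStep_injOn A' (hebd k) (hbd0 x hx.le) h)⟩
  have heinj : ∀ i j, i < j → e i ≠ e j := by
    intro i
    induction i with
    | zero =>
      intro j hj h
      obtain ⟨j, rfl⟩ := Nat.exists_eq_succ_of_ne_zero hj.ne'
      rw [Nat.succ_eq_add_one, hesucc, show e 0 = ((L, -1), (0, 1)) from rfl, ← hstep1] at h
      exact hright j ⟨L + 1, by omega, Or.inr
        (interfaceStep_injOn A' (hebd j) (hbd1 (L + 1) (by omega)) h.symm)⟩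
    | succ i ih =>
      intro j hj h
      obtain ⟨j, rfl⟩ := Nat.exists_eq_succ_of_ne_zero (by omega : j ≠ 0)
      rw [Nat.succ_eq_add_one, hesucc, hesucc] at h
      exact ih j (by omega) (interfaceStep_injOn A' (hebd i) (hebd j) h)
  -- A boundary edge from below the half-plane leads to the bottom line.
  have hdown : ∀ k, (e k).1 ∉ A → (e k).1.2 = -1 ∧ ((e k).2 = (0, 1) ∨ (e k).2 = (-1, 1)) := by
    intro k hk
    obtain ⟨h1, h2, h3⟩ := hebd k
    generalize e k = ek at *
    obtain ⟨⟨ux, uy⟩, d⟩ := ek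
    have huy : uy < 0 := h2.resolve_left hk
    have hv : ¬ (uy + d.2 < 0) := fun h => h3 (Or.inr h)
    simp only [triDirs, Finset.mem_insert, Finset.mem_singleton] at h1
    rcases h1 with rfl | rfl | rfl | rfl | rfl | rfl <;> simp at * <;> omega
  have hex : ∃ k, ((e k).1 + (e k).2).2 = 0 ∧ ((e k).1 + (e k).2).1 < -R := by
    by_contra! hno
    have hF : (((A ∪ (Finset.Icc (-R) L ×ˢ {-1} : Finset (ℤ × ℤ)) : Set (ℤ × ℤ))) ×ˢ
        (triDirs : Set (ℤ × ℤ))).Finite :=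
      (hfin.union (Finset.finite_toSet _)).prod (Finset.finite_toSet _)
    refine Set.infinite_of_injective_forall_mem (f := e) (fun i j h => ?_) (fun k => ?_) hF
    · by_contra hne
      rcases Nat.lt_or_gt_of_ne hne with h' | h'
      · exact heinj i j h' h
      · exact heinj j i h' h.symm
    · refine ⟨?_, (hebd k).1⟩
      by_cases hk : (e k).1 ∈ A
      · exact Or.inl hk
      · refine Or.inr ?_
        obtain ⟨h1, h2⟩ := hdown k hk
        have h3 := hno k
        have h4 := hright k
        generalize e k = ek at *
        obtain ⟨⟨ux, uy⟩, d⟩ := ek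
        simp only at h1 h2
        subst h1
        have h5 : ux ≤ L := by
          by_contra! hlt
          rcases h2 with rfl | rfl
          · exact h4 ⟨ux, hlt, Or.inl rfl⟩
          · exact h4 ⟨ux, hlt, Or.inr rfl⟩
        rcases h2 with rfl | rfl <;> simp at h3 ⊢ <;> omega
  have hinv : ∀ k, (∀ j < k, ¬ (((e j).1 + (e j).2).2 = 0 ∧ ((e j).1 + (e j).2).1 < -R)) →
      (((e k).1 + (e k).2).2 = 0 ∧ R < ((e k).1 + (e k).2).1) ∨
        ∃ z : ℤ × ℤ, z.2 = 0 ∧ R < z.1 ∧ Reached halfTri Z z ((e k).1 + (e k).2) := by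
    intro k
    induction k with
    | zero =>
      intro _
      left
      have hRL := hL _ (hseg R (abs_of_pos hR).le)
      simp only [abs_of_pos hR] at hRL
      simpa [he] using hRL
    | succ k ih =>
      intro hk
      have ih := ih fun j hj => hk j (by omega)
      have hkk := hk k (by omega)
      have hdown := hdown k
      obtain ⟨h1, h2, h3⟩ := hebd k
      obtain ⟨-, -, h3'⟩ := hebd (k + 1)
      rw [hesucc] at h3' ⊢
      generalize e k = ek at *
      obtain ⟨u, d⟩ := ek
      simp only [interfaceStep] at h1 h2 h3 h3' hdown hkk ih ⊢
      split_ifs at h3' ⊢ with hw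
      · simpa only [add_rot_add_rotInv] using ih
      have hv0 : 0 ≤ (u + d).2 := not_lt.1 fun h => h3 (Or.inr h)
      have hw0 : 0 ≤ (u + rot d).2 := not_lt.1 fun h => hw (Or.inr h)
      by_cases hu : u ∈ A
      · right
        have hvZ : u + d ∈ Z := ⟨hv0, fun h => h3 (Or.inl h), u, hu, by simpa using h1⟩
        have hwZ : u + rot d ∈ Z := ⟨hw0, fun h => hw (Or.inl h), u, hu, by
          simpa using rot_mem _ h1⟩
        have hadj : halfTri.Adj (u + d) (u + rot d) := ⟨hv0, hw0, by
          simpa using rot_sub_mem _ h1⟩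
        rcases ih with ⟨ih1, ih2⟩ | ⟨z, hz1, hz2, hz⟩
        · exact ⟨_, ih1, ih2, .step (.base hvZ) hadj hwZ⟩
        · exact ⟨z, hz1, hz2, .step hz hadj hwZ⟩
      · left
        obtain ⟨h4, h5⟩ := hdown hu
        obtain ⟨ux, uy⟩ := u
        simp only at h4
        subst h4
        rcases h5 with rfl | rfl
        · have hv1 : (ux, (0 : ℤ)) ∉ A := fun h => h3 (Or.inl (by simpa using h))
          have hw1 : (ux - 1, (0 : ℤ)) ∉ A := fun h => hw (Or.inl (by
            simpa [rot, sub_eq_add_neg] using h))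
          have hv2 : ¬ |ux| ≤ R := fun h => hv1 (hseg _ h)
          have hw2 : ¬ |ux - 1| ≤ R := fun h => hw1 (hseg _ h)
          simp [rot] at hkk ⊢
          rw [abs_le] at hv2 hw2
          omega
        · simp [rot] at hw0
  have hfind := Nat.find_spec hex
  rcases hinv (Nat.find hex) (fun j hj => Nat.find_min hex hj) with h | ⟨z, hz1, hz2, hz⟩
  · omega
  · exact ⟨z, _, hz1, hz2, hfind.1, hfind.2, hz⟩

/-! ### Counting closed paths -/

/-- The directions in which an induced path of the triangular lattice may continue after a step in
direction `d`: straight on, or a turn by sixty degrees. -/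
def turns (d : ℤ × ℤ) : Finset (ℤ × ℤ) := {rotInv d, d, rot d}

theorem mem_turns_of_add_notMem :
    ∀ a ∈ triDirs, ∀ b ∈ triDirs, a + b ∉ triDirs → a + b ≠ 0 → b ∈ turns a := by decide

theorem mem_turns_or : ∀ a ∈ triDirs, a ∈ turns (1, 0) ∨ a ∈ turns (-1, 0) := by decide

/-- The vertices, without the starting vertex `v`, of the paths of length `m` from `v` that only
make the steps allowed by `turns`, when the step before reaching `v` had direction `d`. -/
def turnPaths : ℕ → ℤ × ℤ → ℤ × ℤ → Finset (List (ℤ × ℤ))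
  | 0, _, _ => {[]}
  | m + 1, v, d => (turns d).biUnion fun d' => (turnPaths m (v + d') d').image (List.cons (v + d'))

theorem card_turnPaths_le (m : ℕ) (v d : ℤ × ℤ) : (turnPaths m v d).card ≤ 3 ^ m := by
  induction m generalizing v d with
  | zero => simp [turnPaths]
  | succ m ih =>
    rw [pow_succ']
    refine (Finset.card_biUnion_le_card_mul _ _ (3 ^ m) fun d' _ => ?_).trans
      (Nat.mul_le_mul_right _ Finset.card_le_three)
    exact Finset.card_image_le.trans (ih _ _)

theorem map_mem_turnPaths (m : ℕ) (f : ℕ → ℤ × ℤ) (d : ℤ × ℤ)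
    (h0 : 0 < m → f 1 - f 0 ∈ turns d)
    (h : ∀ i, i + 2 ≤ m → f (i + 2) - f (i + 1) ∈ turns (f (i + 1) - f i)) :
    (List.range m).map (fun i => f (i + 1)) ∈ turnPaths m (f 0) d := by
  induction m generalizing f d with
  | zero => simp [turnPaths]
  | succ m ih =>
    rw [List.range_succ_eq_map, List.map_cons, List.map_map, turnPaths, Finset.mem_biUnion]
    refine ⟨f 1 - f 0, h0 (Nat.succ_pos m), ?_⟩
    rw [add_sub_cancel, Finset.mem_image]
    refine ⟨_, ih (fun i => f (i + 1)) (f 1 - f 0) (fun hm => h 0 (by omega))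
      (fun i hi => h (i + 1) (by omega)), rfl⟩

/-- The event that the sites of `O` are open and that some allowed path of length `m` from `v` is
closed. -/
def closedPathEvent (O : Finset (ℤ × ℤ)) (m : ℕ) (v : ℤ × ℤ) : Set (Set (ℤ × ℤ)) :=
  {η | (∀ u ∈ O, u ∈ η) ∧ ∃ l ∈ turnPaths m v (1, 0) ∪ turnPaths m v (-1, 0),
    l.Nodup ∧ l.length = m ∧ ∀ u ∈ l, u ∉ η}

theorem setBernoulli_real_open_closed_le {ι : Type*} [DecidableEq ι] (p : unitInterval)
    (O F : Finset ι) :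
    (setBernoulli (Set.univ : Set ι) p).real {η | (∀ u ∈ O, u ∈ η) ∧ ∀ u ∈ F, u ∉ η} ≤
      (p : ℝ) ^ O.card * (1 - (p : ℝ)) ^ F.card := by
  by_cases hOF : Disjoint O F
  · have h := setBernoulli_real_forall_mem_iff p (O ∪ F) (· ∈ O)
    rw [Finset.prod_union hOF, Finset.prod_congr (g := fun _ => (p : ℝ)) rfl
      (fun i hi => if_pos hi), Finset.prod_congr (s₁ := F) (g := fun _ => 1 - (p : ℝ)) rfl
      (fun i hi => if_neg (Finset.disjoint_right.1 hOF hi)), Finset.prod_const,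
      Finset.prod_const] at h
    refine (measureReal_mono ?_).trans_eq h
    rintro η ⟨h1, h2⟩ i hi
    have := Finset.disjoint_right.1 hOF
    rcases Finset.mem_union.1 hi with hi | hi
    · simp [h1 i hi, hi]
    · simp [h2 i hi, this hi]
  · have hempty : {η : Set ι | (∀ u ∈ O, u ∈ η) ∧ ∀ u ∈ F, u ∉ η} = ∅ := by
      obtain ⟨i, hi, hi'⟩ := Finset.not_disjoint_iff.1 hOF
      ext η
      simp only [Set.mem_ofPred_eq, Set.mem_empty_iff_false, iff_false]
      exact fun h => h.2 i hi' (h.1 i hi)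
    rw [hempty, measureReal_empty]
    exact mul_nonneg (pow_nonneg p.2.1 _) (pow_nonneg (sub_nonneg.2 p.2.2) _)

theorem real_closedPathEvent_le (p : unitInterval) (O : Finset (ℤ × ℤ)) (m : ℕ) (v : ℤ × ℤ) :
    (setBernoulli (Set.univ : Set (ℤ × ℤ)) p).real (closedPathEvent O m v) ≤
      2 * (p : ℝ) ^ O.card * (3 * (1 - (p : ℝ))) ^ m := by
  classical
  have hp0 : 0 ≤ (p : ℝ) := p.2.1
  have hq0 : 0 ≤ 1 - (p : ℝ) := sub_nonneg.2 p.2.2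
  set P := (turnPaths m v (1, 0) ∪ turnPaths m v (-1, 0)).filter
    fun l => l.Nodup ∧ l.length = m with hP
  have hcard : (P.card : ℝ) ≤ 2 * 3 ^ m := by
    have h : P.card ≤ 2 * 3 ^ m := by
      refine (Finset.card_filter_le _ _).trans ((Finset.card_union_le _ _).trans ?_)
      have h1 := card_turnPaths_le m v (1, 0)
      have h2 := card_turnPaths_le m v (-1, 0)
      omega
    exact_mod_cast h
  have hsub : closedPathEvent O m v ⊆
      ⋃ l ∈ P, {η | (∀ u ∈ O, u ∈ η) ∧ ∀ u ∈ l.toFinset, u ∉ η} := by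
    rintro η ⟨hO, l, hl, hnd, hlen, hcl⟩
    simp only [Set.mem_iUnion]
    exact ⟨l, Finset.mem_filter.2 ⟨hl, hnd, hlen⟩, hO, fun u hu => hcl u (List.mem_toFinset.1 hu)⟩
  calc _ ≤ _ := measureReal_mono hsub (measure_ne_top _ _)
    _ ≤ ∑ l ∈ P, _ := measureReal_biUnion_finset_le _ _
    _ ≤ ∑ l ∈ P, (p : ℝ) ^ O.card * (1 - (p : ℝ)) ^ m := by
      refine Finset.sum_le_sum fun l hl => ?_
      obtain ⟨-, hnd, hlen⟩ := Finset.mem_filter.1 hl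
      have := setBernoulli_real_open_closed_le p O l.toFinset
      rwa [List.toFinset_card_of_nodup hnd, hlen] at this
    _ = P.card * ((p : ℝ) ^ O.card * (1 - (p : ℝ)) ^ m) := by
      rw [Finset.sum_const, nsmul_eq_mul]
    _ ≤ 2 * 3 ^ m * ((p : ℝ) ^ O.card * (1 - (p : ℝ)) ^ m) := by gcongr
    _ = _ := by rw [mul_pow]; ring

/-- A path in the complement of `η` from `z` that moves `m` units to the left contains, by
shortcutting it to a geodesic, an allowed closed path with `m` steps. -/
theorem mem_closedPathEvent_of_reached {η Z : Set (ℤ × ℤ)} {O : Finset (ℤ × ℤ)}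
    (hO : ∀ u ∈ O, u ∈ η) (hZ : Z ⊆ ηᶜ) (hZ0 : ∀ u ∈ Z, 0 ≤ u.2) {z z' : ℤ × ℤ}
    (hz : Reached halfTri Z z z') (m : ℕ) (hm : (m : ℤ) ≤ z.1 - z'.1) :
    η ∈ closedPathEvent O m z := by
  have hzZ : z ∈ Z := by
    clear hm
    induction hz with
    | base h => exact h
    | step _ _ _ ih => exact ih
  let G := halfTri.induce Z
  obtain ⟨w, hw⟩ : ∃ w : G.Walk ⟨z, hzZ⟩ ⟨z', hz.mem⟩, w.length = G.dist ⟨z, hzZ⟩ ⟨z', hz.mem⟩ :=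
    (hz.reachable hzZ hz.mem).exists_walk_length_eq_dist
  set f : ℕ → ℤ × ℤ := fun i => (w.getVert i : ℤ × ℤ) with hf
  have hadj : ∀ i < w.length, G.Adj (w.getVert i) (w.getVert (i + 1)) := fun i hi =>
    w.adj_getVert_succ hi
  have hdir : ∀ i < w.length, f (i + 1) - f i ∈ triDirs := fun i hi => (hadj i hi).2.2
  have hf0 : f 0 = z := by simp [hf]
  have hfm : f w.length = z' := by simp [hf]
  have hmove : ∀ i ≤ w.length, z.1 - (f i).1 ≤ i := by
    intro i
    induction i with
    | zero => intro _; simp [hf0]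
    | succ i ih =>
      intro hi
      have h1 := abs_fst_le_one _ (hdir i hi)
      rw [Prod.fst_sub, abs_le] at h1
      have := ih (by omega)
      push_cast
      omega
  have hlen : m ≤ w.length := by
    have := hmove w.length le_rfl
    rw [hfm] at this
    omega
  have hreach : ∀ i, G.Reachable ⟨z, hzZ⟩ (w.getVert i) := fun i => (w.take i).reachable
  -- Along a geodesic the distance to the starting point increases by one at each step.
  have hdist : ∀ i ≤ w.length, G.dist ⟨z, hzZ⟩ (w.getVert i) = i := by
    intro i hi
    refine le_antisymm ?_ ?_
    · refine (SimpleGraph.dist_le (w.take i)).trans ?_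
      simp
    · have h1 := SimpleGraph.dist_le (w.drop i)
      have h2 := (hreach i).dist_triangle_left (⟨z', hz.mem⟩ : Z)
      rw [SimpleGraph.Walk.drop_length] at h1
      omega
  have hinj : ∀ i ≤ w.length, ∀ j ≤ w.length, f i = f j → i = j := by
    intro i hi j hj h
    rw [← hdist i hi, ← hdist j hj, Subtype.ext h]
  have hturn : ∀ i, i + 2 ≤ w.length → f (i + 2) - f (i + 1) ∈ turns (f (i + 1) - f i) := by
    intro i hi
    refine mem_turns_of_add_notMem _ (hdir i (by omega)) _ (hdir (i + 1) (by omega)) ?_ ?_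
    · intro h
      have hadj2 : G.Adj (w.getVert i) (w.getVert (i + 2)) :=
        ⟨hZ0 _ (w.getVert i).2, hZ0 _ (w.getVert (i + 2)).2, by
          rwa [sub_add_sub_cancel'] at h⟩
      have h1 := (hreach i).dist_triangle_left (w.getVert (i + 2))
      rw [hdist i (by omega), hdist (i + 2) hi, SimpleGraph.dist_eq_one_iff_adj.2 hadj2] at h1
      omega
    · intro h
      rw [sub_add_sub_cancel', sub_eq_zero] at h
      have := hinj _ hi _ (by omega) h
      omega
  refine ⟨hO, (List.range m).map (fun i => f (i + 1)), ?_, ?_, by simp, ?_⟩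
  · rw [Finset.mem_union, ← hf0]
    rcases Nat.eq_zero_or_pos m with hm0 | hm0
    · exact Or.inl (map_mem_turnPaths m f _ (fun h => absurd h (by omega))
        fun i hi => hturn i (by omega))
    · refine (mem_turns_or _ (hdir 0 (by omega))).imp (fun h => ?_) (fun h => ?_) <;>
        exact map_mem_turnPaths m f _ (fun _ => h) fun i hi => hturn i (by omega)
  · refine (List.nodup_map_iff_inj_on List.nodup_range).2 fun i hi j hj h => ?_
    rw [List.mem_range] at hi hj
    have := hinj _ (by omega) _ (by omega) h
    omega
  · intro u hu
    obtain ⟨i, -, rfl⟩ := List.mem_map.1 hu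
    exact hZ (w.getVert (i + 1)).2

/-- The box of radius `L` around the origin. -/
def box (L : ℕ) : Finset (ℤ × ℤ) := Finset.Icc (-(L : ℤ)) L ×ˢ Finset.Icc (-(L : ℤ)) L

theorem mem_box {L : ℕ} {u : ℤ × ℤ} : u ∈ box L ↔ |u.1| ≤ L ∧ |u.2| ≤ L := by
  simp [box, abs_le, and_assoc]

theorem mem_box_succ_of_adj {L : ℕ} {u v : ℤ × ℤ} (hu : u ∈ box L) (h : v - u ∈ triDirs) :
    v ∈ box (L + 1) := by
  have h1 := abs_fst_le_one _ h
  have h2 := abs_snd_le_one _ h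
  rw [mem_box] at *
  rw [Prod.fst_sub] at h1
  rw [Prod.snd_sub] at h2
  rw [abs_le] at *
  push_cast
  rw [abs_le] at *
  omega

/-- The segment from `(-8, 0)` to `(8, 0)`. It has `17` points, and is long enough for the union
bound in Peierls' estimate because `8 * (3 / 4) ^ 17 ≤ 1 / 2`. -/
def baseSegment : Finset (ℤ × ℤ) := Finset.Icc (-8) 8 ×ˢ {0}

theorem mem_baseSegment {u : ℤ × ℤ} : u ∈ baseSegment ↔ |u.1| ≤ 8 ∧ u.2 = 0 := by
  rw [baseSegment, Finset.mem_product, Finset.mem_Icc, Finset.mem_singleton, abs_le]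

theorem card_baseSegment : baseSegment.card = 17 := by decide

theorem reached_of_baseSegment {η : Set (ℤ × ℤ)} (hη : ∀ u ∈ baseSegment, u ∈ η) (i : ℤ)
    (hi : |i| ≤ 8) : Reached halfTri η (0, 0) (i, 0) := by
  have hmem : ∀ j : ℤ, |j| ≤ 8 → ((j, 0) : ℤ × ℤ) ∈ η := fun j hj =>
    hη _ (mem_baseSegment.2 ⟨hj, rfl⟩)
  have h0 : Reached halfTri η (0, 0) (0, 0) := .base (hmem 0 (by simp))
  have hpos : ∀ n : ℕ, n ≤ 8 → Reached halfTri η (0, 0) ((n : ℤ), 0) := by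
    intro n
    induction n with
    | zero => intro _; exact h0
    | succ n ih =>
      intro hn
      refine .step (ih (by omega)) ⟨le_rfl, le_rfl, ?_⟩ (hmem _ ?_)
      · simp [triDirs]
      · rw [abs_of_nonneg (by positivity)]; omega
  have hneg : ∀ n : ℕ, n ≤ 8 → Reached halfTri η (0, 0) (-(n : ℤ), 0) := by
    intro n
    induction n with
    | zero => intro _; exact h0
    | succ n ih =>
      intro hn
      refine .step (ih (by omega)) ⟨le_rfl, le_rfl, ?_⟩ (hmem _ ?_)
      · simp [triDirs]
      · rw [abs_neg, abs_of_nonneg (by positivity)]; omega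
  rw [abs_le] at hi
  obtain ⟨n, rfl | rfl⟩ := i.eq_nat_or_neg
  · exact hpos n (by omega)
  · exact hneg n (by omega)

/-- If the segment is open and its cluster stays in a box, then a closed path starts on the bottom
line to the right of the segment and is at least as long as it takes to reach the bottom line to the
left of the segment. -/
theorem exists_mem_closedPathEvent {η : Set (ℤ × ℤ)} (L : ℕ) (hη : ∀ u ∈ baseSegment, u ∈ η)
    (hL : ∀ w, Reached halfTri η (0, 0) w → w ∈ box L) :
    ∃ k < L, η ∈ closedPathEvent baseSegment (17 + k) (9 + k, 0) := by
  have hfin : {w | Reached halfTri η (0, 0) w}.Finite := (box L).finite_toSet.subset hL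
  have hge : ∀ w, Reached halfTri η (0, 0) w → 0 ≤ w.2 := by
    intro w hw
    cases hw with
    | base => exact le_rfl
    | step _ h _ => exact h.2.1
  obtain ⟨z, z', hz1, hz2, hz'1, hz'2, hz⟩ := exists_boundary_crossing _ hfin 8 (by norm_num)
    fun i hi => reached_of_baseSegment hη i hi
  have hzZ : z.1 ≤ L + 1 := by
    have : z ∈ {v | 0 ≤ v.2 ∧ v ∉ {w | Reached halfTri η (0, 0) w} ∧
        ∃ u ∈ {w | Reached halfTri η (0, 0) w}, v - u ∈ triDirs} := by
      clear hz'1 hz'2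
      induction hz with
      | base h => exact h
      | step _ _ _ ih => exact ih
    obtain ⟨-, -, u, hu, hdir⟩ := this
    have := (mem_box.1 (mem_box_succ_of_adj (hL u hu) hdir)).1
    rw [abs_le] at this
    push_cast at this
    omega
  refine ⟨(z.1 - 9).toNat, by omega, ?_⟩
  have hz9 : z = (9 + ((z.1 - 9).toNat : ℤ), 0) := by
    ext
    · simp only; omega
    · exact hz1
  rw [← hz9]
  refine mem_closedPathEvent_of_reached hη ?_ (fun u hu => hu.1) hz _ (by push_cast; omega)
  rintro v ⟨hv0, hv, u, hu, hdir⟩ hvη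
  exact hv (Reached.step (u := u) hu ⟨hge u hu, hv0, hdir⟩ hvη)

/-- Peierls' estimate: at density above three quarters, the cluster of the origin in the half-plane
triangular lattice leaves every box with probability bounded below. -/
theorem real_halfTri_bad_le (p : unitInterval) (hp : 3 / 4 < (p : ℝ)) (L : ℕ) :
    (setBernoulli (Set.univ : Set (ℤ × ℤ)) p).real
      {η | ∀ w, Reached halfTri η (0, 0) w → w ∈ box L} ≤ 1 - (p : ℝ) ^ 17 / 2 := by
  set μ := setBernoulli (Set.univ : Set (ℤ × ℤ)) p
  have hp0 : 0 ≤ (p : ℝ) := p.2.1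
  set q : ℝ := 3 * (1 - (p : ℝ)) with hq
  have hq0 : 0 ≤ q := mul_nonneg (by norm_num) (sub_nonneg.2 p.2.2)
  have hq1 : q ≤ 3 / 4 := by rw [hq]; linarith
  have hopen : μ.real {η | ∀ u ∈ baseSegment, u ∈ η} = (p : ℝ) ^ 17 := by
    have := setBernoulli_real_forall_mem_iff p baseSegment (fun _ => True)
    simpa [card_baseSegment] using this
  have hmeas : MeasurableSet {η : Set (ℤ × ℤ) | ∀ u ∈ baseSegment, u ∈ η} := by
    have : {η : Set (ℤ × ℤ) | ∀ u ∈ baseSegment, u ∈ η} = ⋂ u ∈ baseSegment, {η | u ∈ η} := by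
      ext; simp
    rw [this]
    exact Finset.measurableSet_biInter _ fun u _ => measurableSet_mem u
  have hsub : {η | ∀ w, Reached halfTri η (0, 0) w → w ∈ box L} ⊆
      {η | ∀ u ∈ baseSegment, u ∈ η}ᶜ ∪
        ⋃ k ∈ Finset.range L, closedPathEvent baseSegment (17 + k) (9 + k, 0) := by
    intro η hη
    by_cases h : ∀ u ∈ baseSegment, u ∈ η
    · obtain ⟨k, hk, hmem⟩ := exists_mem_closedPathEvent L h hη
      right
      simp only [Set.mem_iUnion]
      exact ⟨k, Finset.mem_range.2 hk, hmem⟩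
    · exact Or.inl h
  have hsum : ∑ k ∈ Finset.range L, 2 * (p : ℝ) ^ 17 * q ^ (17 + k) ≤ (p : ℝ) ^ 17 / 2 := by
    have hgeom : ∑ k ∈ Finset.range L, (3 / 4 : ℝ) ^ k ≤ 4 := by
      rw [geom_sum_eq (by norm_num)]
      have : (0 : ℝ) < (3 / 4) ^ L := by positivity
      rw [div_le_iff_of_neg (by norm_num)]
      linarith
    calc _ ≤ ∑ k ∈ Finset.range L, 2 * (p : ℝ) ^ 17 * (3 / 4) ^ (17 + k) := by gcongr
      _ = 2 * (p : ℝ) ^ 17 * (3 / 4) ^ 17 * ∑ k ∈ Finset.range L, (3 / 4 : ℝ) ^ k := by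
        rw [Finset.mul_sum]
        exact Finset.sum_congr rfl fun k _ => by rw [pow_add]; ring
      _ ≤ 2 * (p : ℝ) ^ 17 * (3 / 4) ^ 17 * 4 := by gcongr
      _ = (p : ℝ) ^ 17 * (8 * (3 / 4) ^ 17) := by ring
      _ ≤ (p : ℝ) ^ 17 * (1 / 2) := by gcongr; norm_num
      _ = _ := by ring
  calc _ ≤ _ := measureReal_mono hsub (measure_ne_top _ _)
    _ ≤ _ := measureReal_union_le _ _
    _ ≤ (1 - (p : ℝ) ^ 17) + ∑ k ∈ Finset.range L, 2 * (p : ℝ) ^ 17 * q ^ (17 + k) := by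
      refine add_le_add ?_ ((measureReal_biUnion_finset_le _ _).trans
        (Finset.sum_le_sum fun k _ => ?_))
      · rw [probReal_compl_eq_one_sub hmeas, hopen]
      · have := real_closedPathEvent_le p baseSegment (17 + k) (9 + k, 0)
        rwa [card_baseSegment] at this
    _ ≤ _ := by linarith

/-! ### Percolation on graphs that project to the triangular lattice -/

/-- A graph to which the steps of the half-plane triangular lattice lift has critical parameter at
most `3 / 4` for site percolation. -/
theorem pcSite_le_of_lift {V : Type u} (H : SimpleGraph V) (π : V → ℤ × ℤ) (o : V)
    (ho : π o = (0, 0))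
    (hlift : ∀ x w, halfTri.Adj (π x) w → ∃ x', H.Adj x x' ∧ π x' = w) : pcSite H ≤ 3 / 4 := by
  refine Real.sSup_le ?_ (by norm_num)
  rintro _ ⟨p, rfl, hp⟩
  by_contra! hlt
  set μ := setBernoulli (Set.univ : Set V) p
  set bad : ℕ → Set (Set V) := fun L => {ω | ∀ v, Reached H ω o v → π v ∈ box L} with hbad
  have hle : ∀ L, μ (bad L) ≤ ENNReal.ofReal (1 - (p : ℝ) ^ 17 / 2) := by
    intro L
    rw [← ofReal_measureReal (measure_ne_top _ _)]
    refine ENNReal.ofReal_le_ofReal ?_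
    have h := real_reached_subset_le (Γ := halfTri) p (box L) (box (L + 1))
      (fun u hu w h => mem_box_succ_of_adj hu h.2.2) hlift o
    rw [ho] at h
    exact h.trans (real_halfTri_bad_le p hlt L)
  have hmono : Monotone bad := by
    intro L L' hLL ω hω v hv
    have := mem_box.1 (hω v hv)
    have hcast : (L : ℤ) ≤ L' := by exact_mod_cast hLL
    exact mem_box.2 ⟨this.1.trans hcast, this.2.trans hcast⟩
  have hcover : Set.univ ⊆ siteEvent H ∪ ⋃ L, bad L := by
    intro ω _
    by_cases hω : HasInfiniteCluster (H.induce ω)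
    · exact Or.inl hω
    right
    have hfin : (π '' {v | Reached H ω o v}).Finite := by
      refine Set.Finite.image _ ?_
      by_cases hoω : o ∈ ω
      · have hc : ((H.induce ω).connectedComponentMk ⟨o, hoω⟩).supp.Finite :=
          Set.not_infinite.1 fun h => hω ⟨_, h⟩
        refine (hc.image Subtype.val).subset fun v hv => ⟨⟨v, hv.mem⟩, ?_, rfl⟩
        exact SimpleGraph.ConnectedComponent.sound (hv.reachable hoω hv.mem).symm
      · convert Set.finite_empty
        ext v
        simp only [Set.mem_ofPred_eq, Set.mem_empty_iff_false, iff_false]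
        intro hv
        induction hv with
        | base h => exact hoω h
        | step _ _ _ ih => exact ih
    obtain ⟨L, hL⟩ := (hfin.image fun u => (max |u.1| |u.2|).toNat).bddAbove
    refine Set.mem_iUnion.2 ⟨L, fun v hv => ?_⟩
    have := hL (Set.mem_image_of_mem _ (Set.mem_image_of_mem π hv))
    rw [mem_box]
    have h1 := le_max_left |(π v).1| |(π v).2|
    have h2 := le_max_right |(π v).1| |(π v).2|
    omega
  have hlt1 : ENNReal.ofReal (1 - (p : ℝ) ^ 17 / 2) < 1 := by
    rw [ENNReal.ofReal_lt_one]
    have : 0 < (p : ℝ) ^ 17 := pow_pos (by linarith) _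
    linarith
  have : (1 : ENNReal) ≤ ENNReal.ofReal (1 - (p : ℝ) ^ 17 / 2) := calc
    1 = μ Set.univ := measure_univ.symm
    _ ≤ _ := measure_mono hcover
    _ ≤ _ := measure_union_le _ _
    _ = ⨆ L, μ (bad L) := by rw [hp, zero_add, hmono.measure_iUnion]
    _ ≤ _ := iSup_le hle
  exact absurd hlt1 this.not_gt

/-! ### Nets and tiles -/

/-- A maximal `a`-separated set: every vertex outside it is at distance less than `a` from it. -/
theorem exists_maximal_separated {V : Type u} (G : SimpleGraph V) (a : ℝ) :
    ∃ V₀ : Set V, (∀ x ∈ V₀, ∀ y ∈ V₀, x ≠ y → a ≤ (G.dist x y : ℝ)) ∧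
      ∀ y : V, y ∈ V₀ ∨ ∃ x ∈ V₀, (G.dist x y : ℝ) < a := by
  obtain ⟨V₀, hV₀⟩ := zorn_subset
    {U : Set V | ∀ x ∈ U, ∀ y ∈ U, x ≠ y → a ≤ (G.dist x y : ℝ)} (by
      intro c hc hchain
      refine ⟨⋃₀ c, ?_, fun s hs => Set.subset_sUnion_of_mem hs⟩
      rintro x ⟨s, hs, hxs⟩ y ⟨t, ht, hyt⟩ hxy
      rcases hchain.total hs ht with h | h
      · exact hc ht x (h hxs) y hyt hxy
      · exact hc hs x hxs y (h hyt) hxy)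
  refine ⟨V₀, hV₀.prop, fun y => ?_⟩
  by_contra! hy
  refine hy.1 (hV₀.le_of_ge (y := insert y V₀) ?_ (Set.subset_insert _ _) (Set.mem_insert _ _))
  rintro x (rfl | hx) z (rfl | hz) hxz
  · exact absurd rfl hxz
  · rw [SimpleGraph.dist_comm]; exact hy.2 z hz
  · exact hy.2 x hx
  · exact hV₀.prop x hx z hz hxz

/-- The tile containing an integer point: the plane is cut into squares of side `2 * n + 1`, and
each row of squares is shifted by `n` against the row below it, so that every tile touches six
others as in the triangular lattice. -/
def tile (n : ℤ) (u : ℤ × ℤ) : ℤ × ℤ :=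
  ((u.1 - n * ((u.2 + n) / (2 * n + 1)) + n) / (2 * n + 1), (u.2 + n) / (2 * n + 1))

/-- The centre of a tile. -/
def tileCenter (n : ℤ) (c : ℤ × ℤ) : ℤ × ℤ := ((2 * n + 1) * c.1 + n * c.2, (2 * n + 1) * c.2)

theorem tile_eq_iff {n : ℤ} (hn : 0 ≤ n) (u c : ℤ × ℤ) :
    tile n u = c ↔ |u.1 - (tileCenter n c).1| ≤ n ∧ |u.2 - (tileCenter n c).2| ≤ n := by
  have key : ∀ x k : ℤ, (x + n) / (2 * n + 1) = k ↔ |x - (2 * n + 1) * k| ≤ n := by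
    intro x k
    rw [Int.ediv_eq_iff_of_pos (by omega), abs_le]
    constructor
    · rintro ⟨h1, h2⟩; constructor <;> linarith
    · rintro ⟨h1, h2⟩; constructor <;> linarith
  obtain ⟨i, j⟩ := c
  simp only [tile, tileCenter, Prod.mk.injEq]
  constructor
  · rintro ⟨h1, h2⟩
    rw [h2, key] at h1
    refine ⟨?_, (key _ _).1 h2⟩
    convert h1 using 2; ring
  · rintro ⟨h1, h2⟩
    rw [← key] at h2
    rw [h2, key]
    refine ⟨?_, rfl⟩
    convert h1 using 2; ring

/-- The coordinates of a point and of the centre of an adjacent tile differ by at most `5 * n + 2`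
in total. -/
theorem abs_tileCenter_sub_le {n : ℤ} (hn : 0 ≤ n) (u d : ℤ × ℤ) (hd : d ∈ triDirs) :
    |(tileCenter n (tile n u + d)).1 - u.1| + |(tileCenter n (tile n u + d)).2 - u.2| ≤
      5 * n + 2 := by
  obtain ⟨h1, h2⟩ := (tile_eq_iff hn u _).1 rfl
  generalize tile n u = c at *
  obtain ⟨x, y⟩ := u
  obtain ⟨i, j⟩ := c
  simp only [tileCenter, Prod.fst_add, Prod.snd_add] at *
  have e1 : ∀ a b : ℤ, (2 * n + 1) * (i + a) + n * (j + b) - x =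
      ((2 * n + 1) * a + n * b) - (x - ((2 * n + 1) * i + n * j)) := by intros; ring
  have e2 : ∀ b : ℤ, (2 * n + 1) * (j + b) - y =
      (2 * n + 1) * b - (y - (2 * n + 1) * j) := by intros; ring
  rw [e1, e2]
  generalize x - ((2 * n + 1) * i + n * j) = s at *
  generalize y - (2 * n + 1) * j = t at *
  refine (add_le_add (abs_sub _ _) (abs_sub _ _)).trans ?_
  have h3 : |(2 * n + 1) * d.1 + n * d.2| + |(2 * n + 1) * d.2| ≤ 3 * n + 2 := by
    simp only [triDirs, Finset.mem_insert, Finset.mem_singleton] at hd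
    rcases hd with rfl | rfl | rfl | rfl | rfl | rfl <;> simp only [abs] <;> omega
  linarith

theorem abs_ediv_sub_ediv_le {N : ℤ} (hN : 0 < N) {x y n : ℤ} (h : |x - y| ≤ N * n) :
    |x / N - y / N| ≤ n := by
  rw [abs_le] at *
  have h1 : x / N ≤ y / N + n := by
    rw [← Int.add_mul_ediv_right y n hN.ne']
    exact Int.ediv_le_ediv hN (by linarith)
  have h2 : y / N ≤ x / N + n := by
    rw [← Int.add_mul_ediv_right x n hN.ne']
    exact Int.ediv_le_ediv hN (by linarith)
  constructor <;> linarith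

/-- A Cayley graph of a group with two independent homomorphisms to `ℤ` has nets with small critical
parameter at every scale. -/
theorem exists_net_of_not_rankLeOne {V : Type u} [Group V] {S : Set V} (hfin : S.Finite)
    (hS : Subgroup.closure S = ⊤) (hV : ¬ RankLeOne V) (a : ℝ) (ha : 1 ≤ a) :
    ∃ V₀ : Set V, IsNet (SimpleGraph.mulCayley S) a (2 * a) V₀ ∧
      pcSite (netGraph (SimpleGraph.mulCayley S) (2 * a) V₀) ≤ 3 / 4 := by
  obtain ⟨α, β, s, t, N, hs, ht, hN, hαs, hαt, hβs, hβt, hα, hβ⟩ := exists_auerbach hfin hS hV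
  set G := SimpleGraph.mulCayley S with hG
  have hconn : G.Connected := mulCayley_connected hS
  obtain ⟨V₀, hsep, hmax⟩ := exists_maximal_separated G a
  -- Distances are integers, so those less than `a` are at most `n`.
  obtain ⟨n, hna, hn⟩ : ∃ n : ℕ, (n : ℝ) < a ∧ ∀ k : ℕ, (k : ℝ) < a → k ≤ n := by
    refine ⟨⌈a⌉₊ - 1, ?_, fun k hk => ?_⟩
    · have h1 : 0 < ⌈a⌉₊ := Nat.ceil_pos.2 (by linarith)
      rw [← Nat.lt_ceil]; omega
    · have := Nat.lt_ceil.2 hk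
      omega
  have hdense : ∀ y : V, ∃ x ∈ V₀, G.dist x y ≤ n := by
    intro y
    rcases hmax y with hy | ⟨x, hx, hxy⟩
    · exact ⟨y, hy, by simp⟩
    · exact ⟨x, hx, hn _ hxy⟩
  have hnet : IsNet G a (2 * a) V₀ := by
    refine ⟨hsep, fun y => ?_⟩
    obtain ⟨x, hx, hxy⟩ := hdense y
    have : (G.dist x y : ℝ) ≤ n := by exact_mod_cast hxy
    exact ⟨x, hx, by linarith⟩
  refine ⟨V₀, hnet, ?_⟩
  let coord : V → ℤ × ℤ := fun x => ((α x).toAdd / N, (β x).toAdd / N)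
  have hcoord : ∀ x y, |(coord x).1 - (coord y).1| ≤ G.dist x y ∧
      |(coord x).2 - (coord y).2| ≤ G.dist x y := fun x y =>
    ⟨abs_ediv_sub_ediv_le hN (abs_sub_le_mul_dist hS α N hα x y),
      abs_ediv_sub_ediv_le hN (abs_sub_le_mul_dist hS β N hβ x y)⟩
  have hmove : ∀ x (m : ℤ × ℤ), coord (x * s ^ m.1 * t ^ m.2) = coord x + m := by
    intro x m
    ext <;> simp [coord, hαs, hαt, hβs, hβt, Int.add_mul_ediv_right _ _ hN.ne']
  have hmoved : ∀ x (m : ℤ × ℤ), (G.dist x (x * s ^ m.1 * t ^ m.2) : ℤ) ≤ |m.1| + |m.2| := by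
    intro x m
    have h1 := hconn.dist_triangle (u := x) (v := x * s ^ m.1) (w := x * s ^ m.1 * t ^ m.2)
    have h2 := dist_mul_gen_zpow_le hS x s hs m.1
    have h3 := dist_mul_gen_zpow_le hS (x * s ^ m.1) t ht m.2
    rw [Int.abs_eq_natAbs, Int.abs_eq_natAbs]
    rw [hG] at *
    omega
  obtain ⟨o, ho, -⟩ := hdense 1
  refine pcSite_le_of_lift _ (fun x => tile n (coord x) - tile n (coord o)) ⟨o, ho⟩ (sub_self _) ?_
  rintro ⟨x, hx⟩ w ⟨-, -, hd⟩
  simp only at hd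
  set d := w - (tile n (coord x) - tile n (coord o)) with hdw
  set m := tileCenter n (tile n (coord x) + d) - coord x with hm
  have hm5 := abs_tileCenter_sub_le (Nat.cast_nonneg n) (coord x) d hd
  rw [← Prod.fst_sub, ← Prod.snd_sub, ← hm] at hm5
  -- Move to the centre of the adjacent tile, and then to a nearby point of the net.
  set y := x * s ^ m.1 * t ^ m.2 with hy
  obtain ⟨x', hx', hx'y⟩ := hdense y
  have htile : tile n (coord x') = tile n (coord x) + d := by
    rw [tile_eq_iff (Nat.cast_nonneg n)]
    have h1 := hcoord x' y
    rw [hmove x m, hm, add_sub_cancel] at h1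
    exact ⟨h1.1.trans (by exact_mod_cast hx'y), h1.2.trans (by exact_mod_cast hx'y)⟩
  have hdist : G.dist x x' ≤ 6 * n + 2 := by
    have h1 := hconn.dist_triangle (u := x) (v := y) (w := x')
    have h2 := hmoved x m
    rw [← hy] at h2
    rw [SimpleGraph.dist_comm] at hx'y
    omega
  refine ⟨⟨x', hx'⟩, ⟨?_, ?_⟩, ?_⟩
  · intro h
    rw [← Subtype.mk.inj h] at htile
    exact ne_zero_of_mem_triDirs d hd (left_eq_add.1 htile)
  · have h1 : (G.dist x x' : ℝ) ≤ 6 * n + 2 := by exact_mod_cast hdist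
    simp only
    linarith
  · simp only
    rw [htile, hdw]
    abel

end NilpotentNets

end

theorem mainTheorem4 :
    NilpotentNets.HasControlledNets.{u}
      (fun (V : Type u) (G : SimpleGraph V) =>
        NilpotentNets.IsNilpotentCayleyGraph G ∧
          (NilpotentNets.pcSite G < 1 ∨ NilpotentNets.pcBond G < 1))
      2 := by
  rintro a ha V G ⟨⟨_, hnil, S, hfin, hS, rfl⟩, hpc⟩
  exact NilpotentNets.exists_net_of_not_rankLeOne hfin hS
    (NilpotentNets.not_rankLeOne_of_pc_lt_one hfin hS hpc) a ha
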